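/- Let $G=(V,\to)$ be a finite directed graph with $n$ vertices and $m$ edges (loops allowed, $\to$ a binary relation on $V$), let $D$ be a depth-first forest of $G$, that is, the ordered forest of discovery edges of some depth-first search of $G$, and let $\mathit{lift}$ be a Boolean. Write $x_h$ for a new element ("exit") attached to a vertex $h$, $\mathrm{DFN}$ for the discovery order of $D$; let $B$ be the set of back edges $u\to v$ ($v$ an ancestor of $u$ in $D$, possibly $u$ itself) and $CF$ the set of cross and forward edges (neither back edges nor edges of $D$). The algorithm $\mathrm{ConstructWPO}^{BU}(G,D,\mathit{lift})$ computes a set $X$ of exits, a set $F$ of scheduling constraints and a set $S$ of stabilization constraints as follows. Initially $X=F=S=\emptyset$. It maintains a partition of $V$ by a disjoint-set structure, where $\mathrm{rep}(v)$ is the representative of the class of $v$ and $\mathrm{merge}(v,h)$ unites the classes of $v$ and $h$ and makes $h$ the representative; initially $\mathrm{rep}(v)=\mathrm{exit}[v]=v$. All edges of $CF$ are removed from $\to$, and each $(u,v)\in CF$ is put into $R[a]$, where $a$ is the lowest common ancestor of $u,v$ in $D$ (a virtual root $\bot$ above all trees if $u,v$ lie in different trees). Then $O[v]:=\{(u,v)\in{\to}\setminus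 B\}$ for all $v$. "Restore $h$" means: for each $(u,v)\in R[h]$ add $(u,\mathrm{rep}(v))$ to $\to$ and $(u,v)$ to $O[\mathrm{rep}(v)]$. "Connect $v$" means: add $(\mathrm{exit}[\mathrm{rep}(u)],v')$ to $F$ for each $(u,v')\in O[v]$ and, if $\mathit{lift}$ is true, also $(\mathrm{exit}[\mathrm{rep}(u)],v)$ for each $(u,v)\in{\to}\setminus B$. For each $h\in V$ in descending $\mathrm{DFN}$: 1. restore $h$; 2. let $P_h=\{\mathrm{rep}(p):(p,h)\in B\}$, $N_h=\emptyset$, $W_h=P_h\setminus\{h\}$; while $W_h\neq\emptyset$, move some $v$ from $W_h$ to $N_h$, and for each $(p,v)\in{\to}\setminus B$ with $\mathrm{rep}(p)\notin N_h\cup\{h\}\cup W_h$ add $\mathrm{rep}(p)$ to $W_h$; 3. if $P_h\ne\emptyset$: connect every $v\in N_h$; add $x_h$ to $X$, $(\mathrm{exit}[\mathrm{rep}(p)],x_h)$ to $F$ for all $p\in P_h$, and $(x_h,h)$ to $S$; set $\mathrm{exit}[h]:=x_h$; $\mathrm{merge}(v,h)$ for all $v\in N_h$. Finally restore $\bot$,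 connect every $v$ with $\mathrm{rep}(v)=v$, and return $(V,X,F,S)$. The algorithm is executed on a unit-cost random access machine with arrays and linked lists; $G$ is given by the list of its edges and $D$ as a linked ordered forest; sets are stored as linked lists (the output lists may repeat items); disjoint sets are implemented with union by rank and path compression; numberings, classification of the edges and lowest common ancestors (off-line, with a second disjoint-set structure) are computed by the algorithm and are included in its running time. Theorem. $\mathrm{ConstructWPO}^{BU}(G,D,\mathit{lift})$ runs in almost-linear time: there is a constant $C$ such that for all $G$, $D$ and $\mathit{lift}$ as above, and whatever the initial content of the memory, the algorithm terminates after at most $C\,(n+m+1)\,(\alpha(n)+1)$ steps, where $\alpha(n)=\min\{k : n\le A(k,k)\}$ is the inverse of the Ackermann function $A$ ($A(0,j)=j+1$, $A(i+1,0)=A(i,1)$, $A(i+1,j+1)=A(i,A(i+1,j))$). -/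

import Mathlib

namespace WPO

/-! ## Depth-first forests -/

/-- Finite ordered forests in first-child / next-sibling form: `node r children siblings` is the tree
with root `r` and immediate subtrees `children`, followed by the trees of `siblings`. -/
inductive Forest (V : Type) : Type
  | nil : Forest V
  | node (r : V) (children siblings : Forest V) : Forest V

/-- `DFS E cand S F S'`: a depth-first search of the relation `E` that starts with the set `S` of
discovered vertices and explores, in some order, the vertices of `cand` that are still undiscovered
when their turn comes, may produce the forest `F`; afterwards the vertices in `S'` are discovered. -/
inductive DFS {V : Type} (E : V → V → Prop) : Set V → Set V → Forest V → Set V → Prop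
  | done {cand S : Set V} : cand ⊆ S → DFS E cand S .nil S
  | visit {cand S S₁ S₂ : Set V} {r : V} {children siblings : Forest V} :
      r ∈ cand → r ∉ S →
      DFS E {v | E r v} (insert r S) children S₁ →
      DFS E cand S₁ siblings S₂ →
      DFS E cand S (.node r children siblings) S₂

/-- `D` is a depth-first forest of the directed graph with edge relation `E`. -/
def IsDepthFirstForest {V : Type} (E : V → V → Prop) (D : Forest V) : Prop :=
  DFS E Set.univ ∅ D Set.univ

/-! ## The machine -/

/-- Elements of a WPO: the vertices, and the exit `x_h` created for the vertex `h`. -/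
inductive Elem (n : ℕ) : Type
  | vtx (v : Fin n) : Elem n
  | exit (h : Fin n) : Elem n

/-- The algorithm uses two disjoint-set structures: `scc` for the partition of the vertices into the
sets that are known to be strongly connected, `anc` for the computation of lowest common ancestors. -/
inductive DSet : Type
  | scc
  | anc
  deriving DecidableEq

/-- The names of the arrays in memory. -/
inductive Arr : Type
  | dfn | post | parent | clock | order
  | link (d : DSet) | rank (d : DSet) | label (d : DSet)
  | back | pred | cross | query
  | exit | R | O
  | markP | markW | N | P | W
  | X | fwd | bwd
  deriving DecidableEq

/-- The content of a cell of each array: a number, a vertex, an element, or a linked list. -/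
abbrev Cell (n : ℕ) : Arr → Type
  -- depth-first number, post-order number, parent in the forest (`none` for a root)
  | .dfn => ℕ
  | .post => ℕ
  | .parent => Option (Fin n)
  -- global: counter of the forest traversal
  | .clock => ℕ
  -- global: the vertices in descending depth-first number
  | .order => List (Fin n)
  -- disjoint sets: parent pointer, rank, and (at the roots) the representative of the set
  | .link _ => Fin n
  | .rank _ => ℕ
  | .label _ => Fin n
  -- `back v`: sources of the back edges into `v` (this is `B`)
  | .back => List (Fin n)
  -- `pred v`: sources of the edges into `v` in the current graph without `B`
  | .pred => List (Fin n)
  -- global: the cross and forward edges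
  | .cross => List (Fin n × Fin n)
  -- `query w`: the cross and forward edges whose endpoint of smaller number is `w`,
  -- together with their other endpoint
  | .query => List (Fin n × (Fin n × Fin n))
  | .exit => Elem n
  | .R => List (Fin n × Fin n)
  | .O => List (Fin n × Fin n)
  -- `markP r = h`: `r` is in `P_h`;  `markW r = h`: `r` is in `N_h` or `W_h`
  | .markP => Option (Fin n)
  | .markW => Option (Fin n)
  -- globals: the sets `N_h`, `P_h`, `W_h` for the current `h`
  | .N => List (Fin n)
  | .P => List (Fin n)
  | .W => List (Fin n)
  -- globals: the output
  | .X => List (Elem n)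
  | .fwd => List (Elem n × Elem n)
  | .bwd => List (Elem n × Elem n)

/-- The memory: every array has a cell for each vertex and one extra cell `none`, which is used
for globals and (in `R`) for the virtual root above all trees of the forest. -/
abbrev Memory (n : ℕ) : Type := (a : Arr) → Option (Fin n) → Cell n a

/-- Programs: from a memory, either no result, or a value, the new memory and the number of steps.
Programs are composed from the instructions `read`, `write`, `test` and `forEach` below, and from
recursive procedures each of whose calls executes at least one instruction. Between two charged steps
only a bounded number of elementary operations on values at hand takes place. -/
def Prog (n : ℕ) (α : Type) : Type := Memory n → Option (α × Memory n × ℕ)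

instance (n : ℕ) : Monad (Prog n) where
  pure a := fun s => some (a, s, 0)
  bind p f := fun s =>
    match p s with
    | none => none
    | some (a, s₁, t₁) =>
      match f a s₁ with
      | none => none
      | some (b, s₂, t₂) => some (b, s₂, t₁ + t₂)

variable {n : ℕ}

/-- No result. -/
def diverge {α : Type} : Prog n α := fun _ => none

/-- One step that does nothing else. -/
def tick : Prog n Unit := fun s => some ((), s, 1)

/-- Read a cell: one step. -/
def read (a : Arr) (i : Option (Fin n)) : Prog n (Cell n a) := fun s => some (s a i, s, 1)

/-- Write a cell: one step. -/
def write (a : Arr) (i : Option (Fin n)) (x : Cell n a) : Prog n Unit :=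
  fun s => some ((), Function.update s a (Function.update (s a) i x), 1)

/-- Evaluate an elementary condition: one step. -/
def test (c : Prop) [Decidable c] : Prog n Bool := do
  tick
  pure (decide c)

/-- Read a cell and write it back changed (used for incrementing a counter and for putting an
item in front of a linked list): two steps. -/
def modify (a : Arr) (i : Option (Fin n)) (f : Cell n a → Cell n a) : Prog n Unit := do
  let x ← read a i
  write a i (f x)

/-- Run through a linked list: one step per item, in addition to the steps of the body. -/
def forEach {α : Type} : List α → (α → Prog n Unit) → Prog n Unit
  | [], _ => tick
  | x :: l, f => do
    tick
    f x
    forEach l f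

/-! ## Disjoint sets, with path compression and union by rank -/

def makeSet (d : DSet) (v : Fin n) : Prog n Unit := do
  write (.link d) v v
  write (.rank d) v 0
  write (.label d) v v

/-- The root of the set of `v`, with path compression. The first argument bounds the depth of the
recursion; there is no result if it is exceeded. -/
def findRoot (d : DSet) : ℕ → Fin n → Prog n (Fin n)
  | 0, _ => diverge
  | k + 1, v => do
    let p ← read (.link d) v
    if ← test (p = v) then
      pure v
    else do
      let r ← findRoot d k p
      write (.link d) v r
      pure r

/-- The representative of the set of `v`. -/
def rep (d : DSet) (v : Fin n) : Prog n (Fin n) := do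
  let r ← findRoot d (n + 1) v
  read (.label d) r

/-- Merge the sets of `v` and `h`; the representative of the new set is `h`. -/
def merge (d : DSet) (v h : Fin n) : Prog n Unit := do
  let a ← findRoot d (n + 1) v
  let b ← findRoot d (n + 1) h
  if ← test (a = b) then
    write (.label d) b h
  else do
    let ra ← read (.rank d) a
    let rb ← read (.rank d) b
    if ← test (rb < ra) then do
      write (.link d) b a
      write (.label d) a h
    else do
      write (.link d) a b
      write (.label d) b h
      if ← test (ra = rb) then
        write (.rank d) b (rb + 1)
      else
        pure ()

/-! ## The algorithm -/

/-- Tabulate the depth-first forest: discovery and finishing times, parents, and the list of the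
vertices in descending depth-first number. The second argument is the parent of the roots. -/
def tabulate : Forest (Fin n) → Option (Fin n) → Prog n Unit
  | .nil, _ => tick
  | .node r children siblings, p => do
    let c ← read .clock none
    write .dfn r c
    write .clock none (c + 1)
    write .parent r p
    modify .order none (fun l => r :: l)
    tabulate children (some r)
    let c' ← read .clock none
    write .post r c'
    write .clock none (c' + 1)
    tabulate siblings p

def setup (D : Forest (Fin n)) : Prog n Unit := do
  write .X none []
  write .fwd none []
  write .bwd none []
  write .cross none []
  write .R none []
  write .clock none 0
  write .order none []
  tabulate D none
  forEach (List.finRange n) fun v => do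
    makeSet .scc v
    makeSet .anc v
    write .exit v (Elem.vtx v)
    write .R v []
    write .O v []
    write .back v []
    write .pred v []
    write .query v []
    write .markP v none
    write .markW v none

/-- Sort the edges into back edges, tree edges, and cross or forward edges. An edge `(u, v)` is a
back edge if `v` is an ancestor of `u` (possibly `u` itself), that is, if `v` is discovered no later
and finished no earlier than `u`. Of the non-back edges, only the tree edges enter `pred` and `O`: the
cross and forward edges are removed from the graph, and are kept in `cross`. -/
def classifyEdges (E : List (Fin n × Fin n)) : Prog n Unit :=
  forEach E fun (u, v) => do
    let du ← read .dfn u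
    let dv ← read .dfn v
    let pu ← read .post u
    let pv ← read .post v
    if ← test (dv ≤ du ∧ pu ≤ pv) then
      modify .back v (fun l => u :: l)
    else do
      let p ← read .parent v
      if ← test (p = some u) then do
        modify .pred v (fun l => u :: l)
        modify .O v (fun l => (u, v) :: l)
      else
        modify .cross none (fun l => (u, v) :: l)

/-- Store each cross or forward edge at the lowest common ancestor of its endpoints (at the virtual
root `none` if they lie in different trees). The lowest common ancestors are found off-line with
disjoint sets: the vertices are processed in descending depth-first number, and a processed vertex is
merged into its parent. When `w` is processed, the representative of the set of a vertex `x` of larger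
number is the lowest common ancestor of `x` and `w`, or, if there is none, the root of the
tree of `x`, whose number is larger than that of `w`. -/
def removeAllCrossForwardEdges : Prog n Unit := do
  let es ← read .cross none
  forEach es fun (u, v) => do
    let du ← read .dfn u
    let dv ← read .dfn v
    if ← test (du < dv) then
      modify .query u (fun l => (v, (u, v)) :: l)
    else
      modify .query v (fun l => (u, (u, v)) :: l)
  let vs ← read .order none
  forEach vs fun w => do
    let qs ← read .query w
    forEach qs fun (x, e) => do
      let a ← rep .anc x
      let da ← read .dfn a
      let dw ← read .dfn w
      if ← test (da ≤ dw) then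
        modify .R (some a) (fun l => e :: l)
      else
        modify .R none (fun l => e :: l)
    let p ← read .parent w
    match p with
    | none => pure ()
    | some p => merge .anc w p

def restoreCrossForwardEdges (h : Option (Fin n)) : Prog n Unit := do
  let es ← read .R h
  forEach es fun (u, v) => do
    let r ← rep .scc v
    modify .pred r (fun l => u :: l)
    modify .O r (fun l => (u, v) :: l)

/-- The worklist loop of `findNestedSCCs`. The first argument bounds the number of
iterations; there is no result if it is exceeded. -/
def searchBackwards (h : Fin n) : ℕ → Prog n Unit
  | 0 => diverge
  | k + 1 => do
    let w ← read .W none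
    match w with
    | [] => pure ()
    | v :: rest => do
      write .W none rest
      modify .N none (fun l => v :: l)
      let ps ← read .pred v
      forEach ps fun p => do
        let r ← rep .scc p
        let m ← read .markW r
        if ← test (r ≠ h ∧ m ≠ some h) then do
          write .markW r (some h)
          modify .W none (fun l => r :: l)
        else
          pure ()
      searchBackwards h k

/-- Compute `N_h` and `P_h`. -/
def findNestedSCCs (h : Fin n) : Prog n Unit := do
  write .P none []
  write .N none []
  write .W none []
  let bs ← read .back h
  forEach bs fun p => do
    let r ← rep .scc p
    let m ← read .markP r
    if ← test (m ≠ some h) then do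
      write .markP r (some h)
      modify .P none (fun l => r :: l)
      if ← test (r ≠ h) then do
        write .markW r (some h)
        modify .W none (fun l => r :: l)
      else
        pure ()
    else
      pure ()
  searchBackwards h (n + 1)

/-- Add the scheduling constraints for the edges that now target `v`. -/
def addConstraints (lift : Bool) (v : Fin n) : Prog n Unit := do
  let es ← read .O v
  forEach es fun (u, v') => do
    let r ← rep .scc u
    let x ← read .exit r
    modify .fwd none (fun l => (x, Elem.vtx v') :: l)
  if ← test (lift = true) then do
    let us ← read .pred v
    forEach us fun u => do
      let r ← rep .scc u
      let x ← read .exit r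
      modify .fwd none (fun l => (x, Elem.vtx v) :: l)
  else
    pure ()

def constructWPOForSCC (lift : Bool) (h : Fin n) : Prog n Unit := do
  findNestedSCCs h
  let ps ← read .P none
  let vs ← read .N none
  if ← test (ps.isEmpty = true) then
    pure ()
  else do
    forEach vs fun v => addConstraints lift v
    modify .X none (fun l => Elem.exit h :: l)
    forEach ps fun p => do
      let r ← rep .scc p
      let x ← read .exit r
      modify .fwd none (fun l => (x, Elem.exit h) :: l)
    modify .bwd none (fun l => (Elem.exit h, Elem.vtx h) :: l)
    write .exit h (Elem.exit h)
    forEach vs fun v => merge .scc v h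

def connectWPOsOfMaximalSCCs (lift : Bool) : Prog n Unit :=
  forEach (List.finRange n) fun v => do
    let r ← rep .scc v
    if ← test (r = v) then
      addConstraints lift v
    else
      pure ()

/-- The output besides `V`: the exits, the scheduling constraints and the stabilization
constraints. The lists stand for sets; an item may be listed more than once. -/
structure Output (n : ℕ) : Type where
  X : List (Elem n)
  fwd : List (Elem n × Elem n)
  bwd : List (Elem n × Elem n)

/-- `ConstructWPO^BU(G, D, lift)` for the graph `G` with vertex set `Fin n` and edge list `E`. -/
def constructWPOBU (E : List (Fin n × Fin n)) (D : Forest (Fin n)) (lift : Bool) :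
    Prog n (Output n) := do
  setup D
  classifyEdges E
  removeAllCrossForwardEdges
  let vs ← read .order none
  forEach vs fun h => do
    restoreCrossForwardEdges (some h)
    constructWPOForSCC lift h
  restoreCrossForwardEdges none
  connectWPOsOfMaximalSCCs lift
  let X ← read .X none
  let fwd ← read .fwd none
  let bwd ← read .bwd none
  pure ⟨X, fwd, bwd⟩

/-- The inverse Ackermann function `α(n) = min {k | n ≤ A(k, k)}`. -/
noncomputable def invAck (n : ℕ) : ℕ := sInf {k | n ≤ ack k k}

end WPO

namespace WPO

/-! ## Program logic -/

variable {n : ℕ} {α β : Type}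

/-! Each list is traversed a bounded number of times per item, so O(n + m) elementary steps and
disjoint-set operations are made, and an operation has amortized cost O(α(n) + 1). Correctness of
the computed constraints plays no role.

Disjoint sets: put L = α(n) + 1, so that n ≤ `hier L 1` (`le_hier_invAck`). An item of rank r whose
parent has rank R holds one unit for each pair (k, i), k < L, i < r, whose iterate `(hier k)^[i+1]
r` still exceeds R; this number is `phi L r R`. Raising R only destroys pairs. On the path of a
find, every step towards the root is paid for by a destroyed pair or by a drop of `findCost`, which
is at most L + 1 (`phi_add_findCost`). A union raises one rank by at most one and so creates at most
L pairs (`IsUF.link`). Hence `run_findRoot` and `run_merge`.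

Main loop: in round h, the lists `pred` and `O` of a vertex are searched and connected only if it
lies in N_h. The members of N_h are distinct representatives, and merging them into h ends that
status. A vertex therefore holds one unit of `credit` while it is a representative and one while its
own round is pending, weighted by the length of its lists. Each round is paid for by the credit that
it releases (`credit_add_le`, `run_mainLoop`), and the credit left at the end pays for connecting
the maximal components. The initial weight is O(n + m), and each restored edge adds two items to a
single vertex. -/

/-- The program `p`, started in `s`, has a result, and `Q` holds of it, of the final memory and of the
number of steps. -/
def Run (p : Prog n α) (s : Memory n) (Q : α → Memory n → ℕ → Prop) : Prop :=
  ∃ a s' t, p s = some (a, s', t) ∧ Q a s' t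

theorem Run.mono {p : Prog n α} {s : Memory n} {Q Q' : α → Memory n → ℕ → Prop}
    (h : Run p s Q) (hQ : ∀ a s' t, Q a s' t → Q' a s' t) : Run p s Q' := by
  obtain ⟨a, s', t, h, hq⟩ := h
  exact ⟨a, s', t, h, hQ _ _ _ hq⟩

theorem run_pure (a : α) (s : Memory n) (Q : α → Memory n → ℕ → Prop) :
    Run (pure a) s Q ↔ Q a s 0 := by
  constructor
  · rintro ⟨_, _, _, h, hq⟩
    cases h
    exact hq
  · exact fun h => ⟨_, _, _, rfl, h⟩

theorem run_bind (p : Prog n α) (f : α → Prog n β) (s : Memory n)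
    (Q : β → Memory n → ℕ → Prop) :
    Run (p >>= f) s Q ↔
      Run p s fun a s₁ t₁ => Run (f a) s₁ fun b s₂ t₂ => Q b s₂ (t₁ + t₂) := by
  have hb : (p >>= f) s = match p s with
    | none => none
    | some (a, s₁, t₁) =>
      match f a s₁ with
      | none => none
      | some (b, s₂, t₂) => some (b, s₂, t₁ + t₂) := rfl
  constructor
  · rintro ⟨b, s', t, h, hq⟩
    rw [hb] at h
    rcases h1 : p s with _ | ⟨a, s₁, t₁⟩
    · simp [h1] at h
    · rcases h2 : f a s₁ with _ | ⟨b', s₂, t₂⟩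
      · simp [h1, h2] at h
      · simp only [h1, h2, Option.some.injEq, Prod.mk.injEq] at h
        obtain ⟨rfl, rfl, rfl⟩ := h
        exact ⟨_, _, _, h1, _, _, _, h2, hq⟩
  · rintro ⟨a, s₁, t₁, h1, b, s₂, t₂, h2, hq⟩
    exact ⟨b, s₂, t₁ + t₂, by rw [hb, h1]; simp only [h2], hq⟩

theorem run_tick (s : Memory n) (Q : Unit → Memory n → ℕ → Prop) :
    Run tick s Q ↔ Q () s 1 := by
  constructor
  · rintro ⟨_, _, _, h, hq⟩
    cases h
    exact hq
  · exact fun h => ⟨_, _, _, rfl, h⟩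

theorem run_read (a : Arr) (i : Option (Fin n)) (s : Memory n)
    (Q : Cell n a → Memory n → ℕ → Prop) :
    @Run n (no_index (Cell n a)) (read a i) s Q ↔ Q (s a i) s 1 := by
  constructor
  · rintro ⟨_, _, _, h, hq⟩
    cases h
    exact hq
  · exact fun h => ⟨_, _, _, rfl, h⟩

theorem run_write (a : Arr) (i : Option (Fin n)) (x : Cell n a) (s : Memory n)
    (Q : Unit → Memory n → ℕ → Prop) :
    Run (write a i x) s Q ↔ Q () (Function.update s a (Function.update (s a) i x)) 1 := by
  constructor
  · rintro ⟨_, _, _, h, hq⟩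
    cases h
    exact hq
  · exact fun h => ⟨_, _, _, rfl, h⟩

theorem run_test (c : Prop) [Decidable c] (s : Memory n) (Q : Bool → Memory n → ℕ → Prop) :
    Run (test c) s Q ↔ Q (decide c) s 1 := by
  simp [test, run_bind, run_tick, run_pure]

theorem run_modify (a : Arr) (i : Option (Fin n)) (f : Cell n a → Cell n a) (s : Memory n)
    (Q : Unit → Memory n → ℕ → Prop) :
    Run (modify a i f) s Q ↔
      Q () (Function.update s a (Function.update (s a) i (f (s a i)))) 2 := by
  simp [modify, run_bind, run_read, run_write]

theorem run_ite (c : Prop) [Decidable c] (p q : Prog n α) (s : Memory n)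
    (Q : α → Memory n → ℕ → Prop) :
    Run (if c then p else q) s Q ↔ (c → Run p s Q) ∧ (¬ c → Run q s Q) := by
  split <;> simp [*]

/-- The rule for loops: `I l s t` holds whenever the items in `l` remain and `t` steps have been
made. -/
theorem run_forEach {l : List α} {f : α → Prog n Unit} {s : Memory n}
    {Q : Unit → Memory n → ℕ → Prop} (I : List α → Memory n → ℕ → Prop) (h0 : I l s 0)
    (hstep : ∀ x l s t, I (x :: l) s t → Run (f x) s fun _ s' t' => I l s' (t + 1 + t'))
    (hend : ∀ s t, I [] s t → Q () s (t + 1)) : Run (forEach l f) s Q := by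
  -- `Run` counts only the steps of the remaining loop, so the steps already made enter as an offset
  -- `t`.
  suffices H : ∀ l s t, I l s t →
      Run (forEach l f) s fun _ s' t' => ∃ t₀, t' + t = t₀ + 1 ∧ I [] s' t₀ from by
    refine (H l s 0 h0).mono ?_
    rintro ⟨⟩ s' t' ⟨t₀, ht, hI⟩
    have : t' = t₀ + 1 := by omega
    exact this ▸ hend _ _ hI
  intro l
  induction l with
  | nil =>
    intro s t h
    simp only [forEach, run_tick]
    exact ⟨t, by omega, h⟩
  | cons x l ih =>
    intro s t h
    simp only [forEach, run_bind, run_tick]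
    refine (hstep x l s t h).mono fun _ s₁ t₁ h₁ => (ih _ _ h₁).mono ?_
    rintro _ s₂ t₂ ⟨t₀, ht, hI⟩
    exact ⟨t₀, by omega, hI⟩

/-- Only the arrays in `A` may have changed. -/
def Frame (A : List Arr) (s s' : Memory n) : Prop := ∀ a, a ∉ A → s' a = s a

theorem Frame.refl (A : List Arr) (s : Memory n) : Frame A s s := fun _ _ => rfl

theorem Frame.trans {A A₁ A₂ : List Arr} {s s₁ s₂ : Memory n} (h : Frame A₁ s s₁)
    (h' : Frame A₂ s₁ s₂) (hA₁ : ∀ a ∈ A₁, a ∈ A) (hA₂ : ∀ a ∈ A₂, a ∈ A) : Frame A s s₂ :=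
  fun a ha => (h' a fun h => ha (hA₂ a h)).trans (h a fun h => ha (hA₁ a h))

theorem Frame.write {A : List Arr} {s s' : Memory n} (h : Frame A s s') {a : Arr}
    (x : Option (Fin n) → Cell n a) (ha : a ∈ A) : Frame A s (Function.update s' a x) := by
  intro b hb
  have hne : b ≠ a := fun e => hb (e.symm ▸ ha)
  rw [Function.update_of_ne hne, h b hb]

/-! ## An Ackermann hierarchy -/

/-- A fast-growing hierarchy of the same strength as Ackermann's function. -/
def hier : ℕ → ℕ → ℕ
  | 0, x => x + 1
  | k + 1, x => (hier k)^[x + 1] x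

theorem lt_hier (k x : ℕ) : x < hier k x := by
  induction k generalizing x with
  | zero => simp [hier]
  | succ k ih =>
    rw [hier, Function.iterate_succ_apply]
    exact (ih x).trans_le (Function.id_le_iterate_of_id_le (fun y => (ih y).le) x _)

theorem le_iterate_hier (k i x : ℕ) : x ≤ (hier k)^[i] x :=
  Function.id_le_iterate_of_id_le (fun y => (lt_hier k y).le) i x

theorem hier_mono (k : ℕ) : Monotone (hier k) := by
  induction k with
  | zero => intro x y h; simpa [hier] using h
  | succ k ih =>
    intro x y h
    calc (hier k)^[x + 1] x ≤ (hier k)^[x + 1] y := ih.iterate _ h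
      _ ≤ (hier k)^[y + 1] y :=
        Function.monotone_iterate_of_id_le (fun z => (lt_hier k z).le) (by omega) y

/-- Unfolding the recursion in the second argument bounds `ack (k + 1) x` by x + 1 iterations of
`hier k` from 1, whereas `hier (k + 1) x` iterates equally often from x; hence the condition 1 ≤ x.
-/
theorem ack_le_hier (k : ℕ) : ∀ x, 1 ≤ x → ack k x ≤ hier k x := by
  induction k with
  | zero => intro x _; simp [hier]
  | succ k ih =>
    have key : ∀ x, ack (k + 1) x ≤ (hier k)^[x + 1] 1 := by
      intro x
      induction x with
      | zero => simpa using ih 1 le_rfl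
      | succ x ihx =>
        rw [ack_succ_succ, Function.iterate_succ_apply']
        exact (ih _ (ack_pos _ _)).trans (hier_mono k ihx)
    intro x hx
    exact (key x).trans ((hier_mono k).iterate _ hx)

/-- One more level absorbs the diagonal: α ≤ `hier α 1`, so A(α, α) is at most two iterations of
`hier α` from 1. This is where the choice L = α(n) + 1 comes from. -/
theorem le_hier_invAck (n : ℕ) : n ≤ hier (invAck n + 1) 1 := by
  have h : n ≤ ack (invAck n) (invAck n) :=
    Nat.sInf_mem (s := {k | n ≤ ack k k}) ⟨n, (lt_ack_left n n).le⟩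
  have h1 : invAck n ≤ hier (invAck n) 1 :=
    (lt_ack_left _ 1).le.trans (ack_le_hier _ 1 le_rfl)
  have h2 : hier (invAck n + 1) 1 = hier (invAck n) (hier (invAck n) 1) := rfl
  have h3 : 1 ≤ hier (invAck n) 1 := (lt_hier _ 1).le
  rw [h2]
  exact h.trans ((ack_mono_right _ h1).trans (ack_le_hier _ _ h3))

/-! ### A counting potential for union by rank with path compression -/

/-- The potential of an item of rank `r` whose parent has rank `R`. -/
def phi (L r R : ℕ) : ℕ :=
  ((Finset.range L ×ˢ Finset.range r).filter fun p => R < (hier p.1)^[p.2 + 1] r).card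

/-- The uncompensated cost of a find from an item of rank `r` to a root of rank `Q`. -/
def findCost (L r Q : ℕ) : ℕ :=
  ((Finset.range L).filter fun k => hier k r ≤ Q).card + if r = 0 then 1 else 0

theorem phi_anti (L r : ℕ) {R Q : ℕ} (h : R ≤ Q) : phi L r Q ≤ phi L r R :=
  Finset.card_le_card fun _ hp => by
    simp only [Finset.mem_filter] at hp ⊢
    exact ⟨hp.1, h.trans_lt hp.2⟩

theorem phi_le (L r R : ℕ) : phi L r R ≤ L * r :=
  (Finset.card_filter_le _ _).trans (by simp)

/-- A root is its own parent, and iterates exceed their starting point, so a root holds the maximum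
that `phi_le` allows. -/
theorem phi_self (L r : ℕ) : phi L r r = L * r := by
  rw [phi, Finset.filter_true_of_mem]
  · simp
  · intro p _
    rw [Function.iterate_succ_apply]
    exact (lt_hier _ _).trans_le (le_iterate_hier _ _ _)

theorem findCost_le (L r Q : ℕ) : findCost L r Q ≤ L + 1 := by
  have := Finset.card_filter_le (Finset.range L) fun k => hier k r ≤ Q
  simp only [Finset.card_range] at this
  unfold findCost
  split <;> omega

/-- The step from an item of rank r to its parent of rank R, followed by compression to the root of
rank Q. Let k be the highest level below L with `hier k r ≤ R`. If `hier k R ≤ Q`, compression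
destroys a pair; otherwise level k counts in `findCost` for r but no longer for R. Rank 0 has no
pairs, and the extra summand of `findCost` pays for it. -/
theorem phi_add_findCost {L r R Q : ℕ} (hL : Q < hier L 1) (hL0 : 0 < L) (hr : r < R)
    (hR : R ≤ Q) : phi L r Q + 1 + findCost L R Q ≤ phi L r R + findCost L r Q := by
  have hsub : ((Finset.range L).filter fun k => hier k R ≤ Q) ⊆
      (Finset.range L).filter fun k => hier k r ≤ Q := fun k hk => by
    simp only [Finset.mem_filter] at hk ⊢
    exact ⟨hk.1, (hier_mono k hr.le).trans hk.2⟩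
  have hphi := phi_anti L r hR
  have hR0 : R ≠ 0 := by omega
  rcases Nat.eq_zero_or_pos r with h0 | h1
  · have := Finset.card_le_card hsub
    simp only [findCost, hR0, if_false, h0, if_true] at this hphi ⊢
    omega
  -- Level 0 qualifies, since `hier 0 r` is r + 1.
  obtain ⟨k, hkL, hk, hmax⟩ : ∃ k < L, hier k r ≤ R ∧ ∀ j, k < j → j < L → R < hier j r := by
    refine ⟨Nat.findGreatest (fun k => hier k r ≤ R) (L - 1), ?_, ?_, ?_⟩
    · have := Nat.findGreatest_le (P := fun k => hier k r ≤ R) (L - 1)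
      omega
    · exact Nat.findGreatest_spec (P := fun k => hier k r ≤ R) (Nat.zero_le _) hr
    · intro j hj hjL
      exact not_le.mp (Nat.findGreatest_is_greatest (P := fun k => hier k r ≤ R) hj (by omega))
  have hr0 : r ≠ 0 := by omega
  by_cases hc : hier k R ≤ Q
  · have : phi L r Q < phi L r R := by
      have key : ∀ p : ℕ × ℕ, p.1 < L → p.2 < r → R < (hier p.1)^[p.2 + 1] r →
          (hier p.1)^[p.2 + 1] r ≤ Q → phi L r Q < phi L r R := by
        intro p h1 h2 h3 h4
        refine Finset.card_lt_card ⟨fun q hq => ?_, fun hs => ?_⟩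
        · simp only [Finset.mem_filter] at hq ⊢
          exact ⟨hq.1, hR.trans_lt hq.2⟩
        · have hp : p ∈ (Finset.range L ×ˢ Finset.range r).filter
              fun p => R < (hier p.1)^[p.2 + 1] r := by
            rw [Finset.mem_filter, Finset.mem_product, Finset.mem_range, Finset.mem_range]
            exact ⟨⟨h1, h2⟩, h3⟩
          have := hs hp
          simp only [Finset.mem_filter] at this
          omega
      -- With i the number of iterations of `hier k` that stay within R, capped at r, one further
      -- iteration stays within `hier k R`, hence within Q.
      let P := fun i => (hier k)^[i] r ≤ R
      have hi1 : 1 ≤ Nat.findGreatest P r := Nat.le_findGreatest (P := P) h1 hk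
      have hi : (hier k)^[Nat.findGreatest P r] r ≤ R :=
        Nat.findGreatest_spec (P := P) h1 hk
      have hQ : (hier k)^[Nat.findGreatest P r + 1] r ≤ Q := by
        rw [Function.iterate_succ_apply']
        exact (hier_mono k hi).trans hc
      -- If i < r, the pair (k, i) is destroyed. If i = r, the further iterate is `hier (k + 1) r`,
      -- and the pair (k + 1, 0), present by maximality of k, is destroyed; k + 1 = L would
      -- contradict Q < `hier L 1`.
      rcases (Nat.findGreatest_le (P := P) r).lt_or_eq with hlt | heq
      · exact key (k, _) hkL hlt
          (not_le.mp (Nat.findGreatest_is_greatest (P := P) (Nat.lt_succ_self _) hlt)) hQ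
      · rw [heq] at hQ
        rcases Nat.lt_or_ge (k + 1) L with h | h
        · exact key (k + 1, 0) h h1 (hmax _ (Nat.lt_succ_self _) h) hQ
        · have : k + 1 = L := by omega
          subst this
          exact absurd (hL.trans_le ((hier_mono _ h1).trans hQ)) (lt_irrefl _)
    have := Finset.card_le_card hsub
    simp only [findCost, hR0, hr0, if_false] at *
    omega
  · have : ((Finset.range L).filter fun k => hier k R ≤ Q).card <
        ((Finset.range L).filter fun k => hier k r ≤ Q).card := by
      refine Finset.card_lt_card ⟨hsub, fun hs => ?_⟩
      have hm : k ∈ (Finset.range L).filter fun k => hier k r ≤ Q := by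
        simp [hkL, hk.trans hR]
      have := hs hm
      simp only [Finset.mem_filter] at this
      exact hc this.2
    simp only [findCost, hR0, hr0, if_false]
    omega

/-! ## Disjoint sets -/

/-- The parent of `x`. -/
def lnk (d : DSet) (s : Memory n) (x : Fin n) : Fin n := s (.link d) (some x)

/-- The rank of `x`. -/
def rnk (d : DSet) (s : Memory n) (x : Fin n) : ℕ := s (.rank d) (some x)

/-- The label of `x`. -/
def lbl (d : DSet) (s : Memory n) (x : Fin n) : Fin n := s (.label d) (some x)

/-- The arrays of the disjoint-set structure `d` are consistent, and `ρ` maps each item to its root. -/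
structure IsUF (d : DSet) (ρ : Fin n → Fin n) (s : Memory n) : Prop where
  rank_lt : ∀ x, lnk d s x ≠ x → rnk d s x < rnk d s (lnk d s x)
  rank_bd : ∀ x, rnk d s x < n
  sum_le : ∑ x, (if lnk d s x = x then rnk d s x + 1 else 0) ≤ n
  lnk_root : ∀ x, lnk d s (ρ x) = ρ x
  root_lnk : ∀ x, ρ (lnk d s x) = ρ x
  root_eq : ∀ x, lnk d s x = x → ρ x = x
  root_lbl : ∀ x, ρ (lbl d s (ρ x)) = ρ x

/-- The potential of the disjoint-set structure `d`. -/
def pot (L : ℕ) (d : DSet) (s : Memory n) : ℕ :=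
  3 * ∑ x, phi L (rnk d s x) (rnk d s (lnk d s x))

theorem pot_congr (L : ℕ) {d : DSet} {s s' : Memory n} (h1 : s' (.link d) = s (.link d))
    (h2 : s' (.rank d) = s (.rank d)) : pot L d s' = pot L d s := by
  simp only [pot, lnk, rnk, h1, h2]

theorem IsUF.congr {d : DSet} {ρ : Fin n → Fin n} {s s' : Memory n} (h : IsUF d ρ s)
    (h1 : s' (.link d) = s (.link d)) (h2 : s' (.rank d) = s (.rank d))
    (h3 : s' (.label d) = s (.label d)) : IsUF d ρ s' := by
  have e1 : lnk d s' = lnk d s := by funext x; simp only [lnk, h1]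
  have e2 : rnk d s' = rnk d s := by funext x; simp only [rnk, h2]
  have e3 : lbl d s' = lbl d s := by funext x; simp only [lbl, h3]
  constructor
  · rw [e1, e2]; exact h.rank_lt
  · rw [e2]; exact h.rank_bd
  · rw [e1, e2]; exact h.sum_le
  · rw [e1]; exact h.lnk_root
  · rw [e1]; exact h.root_lnk
  · rw [e1]; exact h.root_eq
  · rw [e3]; exact h.root_lbl

theorem IsUF.root_root {d : DSet} {ρ : Fin n → Fin n} {s : Memory n} (h : IsUF d ρ s)
    (x : Fin n) : ρ (ρ x) = ρ x := h.root_eq _ (h.lnk_root x)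

theorem IsUF.rank_le_root {d : DSet} {ρ : Fin n → Fin n} {s : Memory n} (h : IsUF d ρ s)
    (x : Fin n) : rnk d s x ≤ rnk d s (ρ x) := by
  obtain ⟨k, hk⟩ : ∃ k, n ≤ k + rnk d s x := ⟨n, by omega⟩
  induction k generalizing x with
  | zero => exact absurd (h.rank_bd x) (by omega)
  | succ k ih =>
    by_cases hx : lnk d s x = x
    · rw [h.root_eq x hx]
    · have h1 := h.rank_lt x hx
      have h2 := ih (lnk d s x) (by omega)
      rw [h.root_lnk] at h2
      omega

/-! ### Find with path compression -/

theorem lnk_write_link (d : DSet) (s : Memory n) (v r x : Fin n) :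
    lnk d (Function.update s (.link d) (Function.update (s (.link d)) (some v) r)) x =
      if x = v then r else lnk d s x := by
  simp only [lnk, Function.update_self, Function.update_apply, Option.some.injEq]

theorem rnk_write_link (d : DSet) (s : Memory n) (v r x : Fin n) :
    rnk d (Function.update s (.link d) (Function.update (s (.link d)) (some v) r)) x =
      rnk d s x := by
  simp [rnk]

theorem lbl_write_link (d : DSet) (s : Memory n) (v r x : Fin n) :
    lbl d (Function.update s (.link d) (Function.update (s (.link d)) (some v) r)) x =
      lbl d s x := by
  simp [lbl]

/-- Only a non-root is redirected, to a root of larger rank, so the set of roots is unchanged. -/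
theorem IsUF.compress {d : DSet} {ρ : Fin n → Fin n} {s : Memory n} (h : IsUF d ρ s)
    {v : Fin n} (hv : lnk d s v ≠ v) :
    IsUF d ρ (Function.update s (.link d) (Function.update (s (.link d)) (some v) (ρ v))) := by
  have hlt : rnk d s v < rnk d s (ρ v) :=
    (h.rank_lt v hv).trans_le (h.root_lnk v ▸ h.rank_le_root (lnk d s v))
  have hρ : ρ v ≠ v := fun e => by rw [e] at hlt; exact lt_irrefl _ hlt
  have hiff : ∀ x, (if x = v then ρ v else lnk d s x) = x ↔ lnk d s x = x := by
    intro x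
    split
    · next e => subst e; exact ⟨fun e => absurd e hρ, fun e => absurd e hv⟩
    · exact Iff.rfl
  have hne : ∀ x, ρ x ≠ v := fun x e => hv (by rw [← e]; exact h.lnk_root x)
  constructor
  · intro x
    simp only [lnk_write_link, rnk_write_link]
    split
    · next e => subst e; exact fun _ => hlt
    · exact h.rank_lt x
  · simpa only [rnk_write_link] using h.rank_bd
  · simpa only [rnk_write_link, lnk_write_link, hiff] using h.sum_le
  · intro x
    simpa only [lnk_write_link, hne, if_false] using h.lnk_root x
  · intro x
    simp only [lnk_write_link]
    split
    · next e => subst e; exact h.root_root x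
    · exact h.root_lnk x
  · intro x
    simp only [lnk_write_link, hiff]
    exact h.root_eq x
  · simpa only [lbl_write_link] using h.root_lbl

theorem pot_write_link (L : ℕ) (d : DSet) (s : Memory n) (v r : Fin n) :
    pot L d (Function.update s (.link d) (Function.update (s (.link d)) (some v) r)) +
        3 * phi L (rnk d s v) (rnk d s (lnk d s v)) =
      pot L d s + 3 * phi L (rnk d s v) (rnk d s r) := by
  simp only [pot, lnk_write_link, rnk_write_link]
  rw [← Finset.add_sum_erase _ _ (Finset.mem_univ v),
    ← Finset.add_sum_erase (Finset.univ) (fun x => phi L (rnk d s x) (rnk d s (lnk d s x)))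
      (Finset.mem_univ v)]
  rw [Finset.sum_congr rfl (g := fun x => phi L (rnk d s x) (rnk d s (lnk d s x)))]
  · simp only [if_true]; ring
  · intro x hx
    rw [if_neg (Finset.ne_of_mem_erase hx)]

/-- Ranks increase along the path and stay below n, so the recursion bound suffices. A non-root
costs three steps (read, test, write), whence the factor 3 in `pot`. The clause on smaller ranks
guarantees that the recursive call leaves the pointer of `v` alone, so that its old parent enters
the balance when it is redirected. -/
theorem run_findRoot {L : ℕ} (hL : n ≤ hier L 1) (hL0 : 0 < L) (d : DSet) (ρ : Fin n → Fin n)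
    (k : ℕ) (v : Fin n) (s : Memory n) (h : IsUF d ρ s) (hk : n ≤ k + rnk d s v) :
    Run (findRoot d k v) s fun r s' t => r = ρ v ∧ IsUF d ρ s' ∧ Frame [.link d] s s' ∧
      (∀ x, rnk d s x < rnk d s v → lnk d s' x = lnk d s x) ∧
      t + pot L d s' ≤ pot L d s + 3 * (findCost L (rnk d s v) (rnk d s (ρ v)) + 1) := by
  induction k generalizing v with
  | zero => exact absurd (h.rank_bd v) (by omega)
  | succ k ih =>
    simp only [findRoot, run_bind, run_read, run_test, run_ite, run_pure, run_write,
      decide_eq_true_eq]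
    change (lnk d s v = v → _) ∧ (¬ lnk d s v = v → Run (findRoot d k (lnk d s v)) s _)
    refine ⟨fun hv => ?_, fun hv => ?_⟩
    · exact ⟨(h.root_eq v hv).symm, h, Frame.refl _ _, fun _ _ => trivial, by omega⟩
    · have hlt := h.rank_lt v hv
      refine (ih (lnk d s v) (by omega)).mono ?_
      rintro r s' t ⟨hr, hU, hF, hx, ht⟩
      rw [h.root_lnk] at hr ht
      subst hr
      have hl : lnk d s' v = lnk d s v := hx v hlt
      have hrk : ∀ x, rnk d s' x = rnk d s x := fun x => by
        simp only [rnk, hF (.rank d) (by simp)]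
      refine ⟨rfl, hU.compress (by rwa [hl]), hF.write _ (by simp), ?_, ?_⟩
      · intro x hxv
        rw [lnk_write_link, if_neg (by rintro rfl; exact lt_irrefl _ hxv)]
        exact hx x (hxv.trans hlt)
      · have h1 := pot_write_link L d s' v (ρ v)
        rw [hl, hrk, hrk, hrk] at h1
        have h2 := phi_add_findCost (L := L) (r := rnk d s v) (R := rnk d s (lnk d s v))
          (Q := rnk d s (ρ v)) ((h.rank_bd _).trans_le hL) hL0 hlt
          (h.root_lnk v ▸ h.rank_le_root (lnk d s v))
        omega

/-- The amortized cost of an operation on disjoint sets. -/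
def opCost (L : ℕ) : ℕ := 9 * L + 30

theorem run_findRoot' {L : ℕ} (hL : n ≤ hier L 1) (hL0 : 0 < L) (d : DSet) (ρ : Fin n → Fin n)
    (v : Fin n) (s : Memory n) (h : IsUF d ρ s) :
    Run (findRoot d (n + 1) v) s fun r s' t => r = ρ v ∧ IsUF d ρ s' ∧ Frame [.link d] s s' ∧
      t + pot L d s' ≤ pot L d s + (3 * L + 6) := by
  refine (run_findRoot hL hL0 d ρ (n + 1) v s h (by omega)).mono ?_
  rintro r s' t ⟨hr, hU, hF, -, ht⟩
  have := findCost_le L (rnk d s v) (rnk d s (ρ v))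
  exact ⟨hr, hU, hF, by omega⟩

/-! ### Representatives and union by rank -/

/-- `σ` maps each vertex to the representative of its set. -/
def IsRep (d : DSet) (σ : Fin n → Fin n) (s : Memory n) : Prop :=
  ∃ ρ, IsUF d ρ s ∧ ∀ x, σ x = lbl d s (ρ x)

theorem IsRep.idem {d : DSet} {σ : Fin n → Fin n} {s : Memory n} (h : IsRep d σ s) (x : Fin n) :
    σ (σ x) = σ x := by
  obtain ⟨ρ, hU, hσ⟩ := h
  simp only [hσ, hU.root_lbl]

theorem IsRep.congr {d : DSet} {σ : Fin n → Fin n} {s s' : Memory n} (h : IsRep d σ s)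
    (h1 : s' (.link d) = s (.link d)) (h2 : s' (.rank d) = s (.rank d))
    (h3 : s' (.label d) = s (.label d)) : IsRep d σ s' := by
  obtain ⟨ρ, hU, hσ⟩ := h
  exact ⟨ρ, hU.congr h1 h2 h3, fun x => by rw [hσ]; simp only [lbl, h3]⟩

theorem run_rep {L : ℕ} (hL : n ≤ hier L 1) (hL0 : 0 < L) {d : DSet} {σ : Fin n → Fin n}
    (v : Fin n) {s : Memory n} (h : IsRep d σ s) :
    Run (rep d v) s fun r s' t => r = σ v ∧ IsRep d σ s' ∧ Frame [.link d] s s' ∧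
      t + pot L d s' ≤ pot L d s + opCost L := by
  obtain ⟨ρ, hU, hσ⟩ := h
  simp only [rep, run_bind, run_read]
  refine (run_findRoot' hL hL0 d ρ v s hU).mono ?_
  rintro r s' t ⟨rfl, hU', hF, ht⟩
  have hl : ∀ x, lbl d s' x = lbl d s x := fun x => by
    simp only [lbl, hF (.label d) (by simp)]
  refine ⟨(hl _).trans (hσ v).symm, ⟨ρ, hU', fun x => ?_⟩, hF, ?_⟩
  · rw [hl, hσ]
  · unfold opCost; omega

/-- Linking the root `a` below the root `b`, where `q` is the new rank of `b` and `l` the new label. -/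
theorem IsUF.link {L : ℕ} {d : DSet} {ρ : Fin n → Fin n} {s s' : Memory n} (h : IsUF d ρ s)
    {a b : Fin n} (hab : a ≠ b) (ha : lnk d s a = a) (hb : lnk d s b = b)
    {q : ℕ} (hq : rnk d s a < rnk d s b ∧ q = rnk d s b ∨
      rnk d s a = rnk d s b ∧ q = rnk d s b + 1) {l : Fin n} (hl : ρ l = a ∨ ρ l = b)
    (hlnk : ∀ x, lnk d s' x = if x = a then b else lnk d s x)
    (hrnk : ∀ x, rnk d s' x = if x = b then q else rnk d s x)
    (hlbl : ∀ x, lbl d s' x = if x = b then l else lbl d s x) :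
    IsUF d (fun x => if ρ x = a ∨ ρ x = b then b else ρ x) s' ∧
      pot L d s' ≤ pot L d s + 3 * L := by
  have hρa : ρ a = a := h.root_eq a ha
  have hρb : ρ b = b := h.root_eq b hb
  have hq1 : rnk d s b ≤ q := by omega
  have hq2 : q ≤ rnk d s b + 1 := by omega
  have haq : rnk d s a < q := by omega
  have hmono : ∀ x, rnk d s x ≤ rnk d s' x := by
    intro x
    rw [hrnk]
    split
    · next e => subst e; exact hq1
    · exact le_rfl
  -- Linking removes the positive term of `a` and raises that of `b` by at most one, so the sum over
  -- the roots does not grow. It yields the bound n on ranks without any set sizes.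
  have hsum : ∑ x, (if lnk d s' x = x then rnk d s' x + 1 else 0) ≤ n := by
    refine le_trans ?_ h.sum_le
    rw [← Finset.add_sum_erase _ _ (Finset.mem_univ a),
      ← Finset.add_sum_erase _ _ (Finset.mem_erase.mpr ⟨hab.symm, Finset.mem_univ b⟩),
      ← Finset.add_sum_erase _ (fun x => if lnk d s x = x then rnk d s x + 1 else 0)
        (Finset.mem_univ a),
      ← Finset.add_sum_erase _ (fun x => if lnk d s x = x then rnk d s x + 1 else 0)
        (Finset.mem_erase.mpr ⟨hab.symm, Finset.mem_univ b⟩)]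
    rw [Finset.sum_congr rfl (g := fun x => if lnk d s x = x then rnk d s x + 1 else 0)]
    · simp only [hlnk, hrnk, ha, hb, if_true, hab, hab.symm, if_false]
      omega
    · intro x hx
      simp only [Finset.mem_erase] at hx
      simp only [hlnk, hrnk, hx.1, hx.2.1, if_false]
  constructor
  · constructor
    · intro x
      rw [hlnk]
      split
      · next e =>
        subst e
        intro _
        rw [hrnk, hrnk, if_neg hab, if_pos rfl]
        exact haq
      · intro hx
        have hxb : x ≠ b := fun e => hx (e ▸ hb)
        rw [hrnk x, if_neg hxb]
        exact (h.rank_lt x hx).trans_le (hmono _)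
    · intro x
      by_cases hx : x = b
      · subst hx
        have := (Finset.single_le_sum (f := fun x => if lnk d s' x = x then rnk d s' x + 1 else 0)
          (fun _ _ => Nat.zero_le _) (Finset.mem_univ x)).trans hsum
        simp only [hlnk, hab.symm, if_false, hb, if_true] at this
        omega
      · rw [hrnk, if_neg hx]
        exact h.rank_bd x
    · exact hsum
    · intro x
      simp only [hlnk]
      by_cases hc : ρ x = a ∨ ρ x = b
      · rw [if_pos hc, if_neg hab.symm, hb]
      · rw [if_neg hc, if_neg (fun e => hc (Or.inl e)), h.lnk_root]
    · intro x
      simp only [hlnk]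
      by_cases hx : x = a
      · subst hx
        simp [hρa, hρb]
      · simp only [if_neg hx, h.root_lnk]
    · intro x
      rw [hlnk]
      split
      · next e => exact fun e' => absurd (e.symm.trans e'.symm) hab
      · next hx =>
        intro hlx
        simp only [h.root_eq x hlx, hx, false_or]
        split
        · next e => exact e.symm
        · rfl
    · intro x
      simp only [hlbl]
      by_cases hc : ρ x = a ∨ ρ x = b
      · simp only [if_pos hc, if_true, if_pos hl]
      · have hxb : ρ x ≠ b := fun e => hc (Or.inr e)
        simp only [if_neg hc, if_neg hxb, h.root_lbl]
  -- Only `b` can gain pairs, at most L of them: `a` already held the maximum as a root, and the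
  -- children of `b` see a parent of no smaller rank.
  · have key : ∀ x, phi L (rnk d s' x) (rnk d s' (lnk d s' x)) ≤
        phi L (rnk d s x) (rnk d s (lnk d s x)) + if x = b then L else 0 := by
      intro x
      by_cases hx : x = b
      · subst hx
        simp only [if_true, hlnk, hab.symm, if_false, hb, phi_self, hrnk]
        calc L * q ≤ L * (rnk d s x + 1) := Nat.mul_le_mul_left _ hq2
          _ = _ := by ring
      · rw [if_neg hx, Nat.add_zero, hrnk x, if_neg hx, hlnk]
        split
        · next e =>
          subst e
          rw [ha, phi_self]
          exact phi_le _ _ _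
        · exact phi_anti _ _ (hmono _)
    have := Finset.sum_le_sum fun x (_ : x ∈ Finset.univ) => key x
    rw [Finset.sum_add_distrib, Finset.sum_ite_eq' Finset.univ b] at this
    simp only [Finset.mem_univ, if_true] at this
    unfold pot
    omega

theorem IsUF.relabel {d : DSet} {ρ : Fin n → Fin n} {s s' : Memory n} (h : IsUF d ρ s)
    {b l : Fin n} (hl : ρ l = b) (h1 : s' (.link d) = s (.link d))
    (h2 : s' (.rank d) = s (.rank d))
    (hlbl : ∀ x, lbl d s' x = if x = b then l else lbl d s x) : IsUF d ρ s' := by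
  have e1 : lnk d s' = lnk d s := by funext x; simp only [lnk, h1]
  have e2 : rnk d s' = rnk d s := by funext x; simp only [rnk, h2]
  constructor
  · rw [e1, e2]; exact h.rank_lt
  · rw [e2]; exact h.rank_bd
  · rw [e1, e2]; exact h.sum_le
  · rw [e1]; exact h.lnk_root
  · rw [e1]; exact h.root_lnk
  · rw [e1]; exact h.root_eq
  · intro x
    rw [hlbl]
    split
    · next e => rw [hl, e]
    · exact h.root_lbl x

/-- Two finds at 3L + 6 each, 3L for the link and a few instructions fit into `opCost L`. Only what
the accounting needs is recorded about the new partition: no vertex but `h` can become a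
representative, and `v` ceases to be one unless it equals `h`. -/
theorem run_merge {L : ℕ} (hL : n ≤ hier L 1) (hL0 : 0 < L) {d : DSet} {σ : Fin n → Fin n}
    (v h : Fin n) {s : Memory n} (hR : IsRep d σ s) :
    Run (merge d v h) s fun _ s' t => (∃ σ', IsRep d σ' s' ∧
        ∀ x, σ' x = x → x = h ∨ σ x = x ∧ x ≠ v) ∧
      Frame [.link d, .rank d, .label d] s s' ∧ t + pot L d s' ≤ pot L d s + opCost L := by
  obtain ⟨ρ, hU, hσ⟩ := hR
  simp only [merge, run_bind]
  refine (run_findRoot' hL hL0 d ρ v s hU).mono ?_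
  rintro _ s₁ t₁ ⟨rfl, hU₁, hF₁, ht₁⟩
  refine (run_findRoot' hL hL0 d ρ h s₁ hU₁).mono ?_
  rintro _ s₂ t₂ ⟨rfl, hU₂, hF₂, ht₂⟩
  have hF : Frame [.link d, .rank d, .label d] s s₂ :=
    hF₁.trans hF₂ (by simp) (by simp)
  have hl : ∀ x, lbl d s₂ x = lbl d s x := fun x => by
    simp only [lbl, hF₂ (.label d) (by simp), hF₁ (.label d) (by simp)]
  -- Shared by the four branches: the united set has root `b` with label `h`, and the other sets
  -- keep their roots and labels.
  have fin : ∀ (ρ' : Fin n → Fin n) (s' : Memory n) (b : Fin n), IsUF d ρ' s' →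
      (∀ x, ρ x = ρ v ∨ ρ x = ρ h → ρ' x = b) →
      (∀ x, ¬ (ρ x = ρ v ∨ ρ x = ρ h) → ρ' x = ρ x) →
      (∀ x, lbl d s' x = if x = b then h else lbl d s₂ x) →
      ∃ σ', IsRep d σ' s' ∧ ∀ x, σ' x = x → x = h ∨ σ x = x ∧ x ≠ v := by
    intro ρ' s' b hU' hρ' hρ'' hl'
    refine ⟨_, ⟨ρ', hU', fun _ => rfl⟩, fun x hx => ?_⟩
    rw [hl'] at hx
    split at hx
    · exact Or.inl hx.symm
    · next hb =>
      by_cases hc : ρ x = ρ v ∨ ρ x = ρ h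
      · exact absurd (hρ' x hc) hb
      · rw [hρ'' x hc, hl, ← hσ] at hx
        exact Or.inr ⟨hx, fun e => hc (Or.inl (e ▸ rfl))⟩
  have hv := hU₂.lnk_root v
  have hh := hU₂.lnk_root h
  simp only [run_bind, run_test, run_ite, run_write, run_read, run_pure, decide_eq_true_eq]
  change (ρ v = ρ h → _) ∧ (ρ v ≠ ρ h → (rnk d s₂ (ρ h) < rnk d s₂ (ρ v) → _) ∧
    (¬ rnk d s₂ (ρ h) < rnk d s₂ (ρ v) → (rnk d s₂ (ρ v) = rnk d s₂ (ρ h) → _) ∧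
      (rnk d s₂ (ρ v) ≠ rnk d s₂ (ρ h) → _)))
  refine ⟨fun hab => ?_, fun hab => ⟨fun hr => ?_, fun hr => ⟨fun hr' => ?_, fun hr' => ?_⟩⟩⟩
  · have hlbl : ∀ x, lbl d (Function.update s₂ (.label d)
        (Function.update (s₂ (.label d)) (some (ρ h)) h)) x =
          if x = ρ h then h else lbl d s₂ x := by
      intro x
      simp only [lbl, Function.update_self, Function.update_apply, Option.some.injEq]
    refine ⟨fin ρ _ (ρ h) (hU₂.relabel rfl (by simp) (by simp) hlbl) (fun x hx => ?_)
      (fun _ _ => rfl) hlbl, hF.write _ (by simp), ?_⟩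
    · rcases hx with hx | hx
      · rw [hx, hab]
      · exact hx
    · rw [pot_congr L (s := s₂) (by simp) (by simp)]
      unfold opCost
      omega
  · have hlbl : ∀ x, lbl d (Function.update (Function.update s₂ (.link d)
        (Function.update (s₂ (.link d)) (some (ρ h)) (ρ v))) (.label d)
        (Function.update (s₂ (.label d)) (some (ρ v)) h)) x =
          if x = ρ v then h else lbl d s₂ x := by
      intro x
      simp only [lbl, Function.update_self, Function.update_apply, Option.some.injEq]
    have H := hU₂.link (L := L) hab.symm hh hv (Or.inl ⟨hr, rfl⟩) (Or.inl rfl)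
      (fun x => by
        simp only [lnk, Function.update_self, Function.update_apply, Option.some.injEq, ne_eq,
          reduceCtorEq, not_false_eq_true, Function.update_of_ne])
      (fun x => by
        simp only [rnk, ne_eq, reduceCtorEq, not_false_eq_true, Function.update_of_ne]
        split
        · next e => rw [e]
        · rfl) hlbl
    refine ⟨fin _ _ (ρ v) H.1 (fun x hx => if_pos hx.symm)
      (fun x hx => if_neg (fun e => hx e.symm)) hlbl, (hF.write _ (by simp)).write _ (by simp), ?_⟩
    have := H.2
    simp only [ne_eq, reduceCtorEq, not_false_eq_true, Function.update_of_ne] at this ⊢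
    unfold opCost
    omega
  · have hlbl : ∀ x, lbl d (Function.update (Function.update (Function.update s₂ (.link d)
        (Function.update (s₂ (.link d)) (some (ρ v)) (ρ h))) (.label d)
        (Function.update (s₂ (.label d)) (some (ρ h)) h)) (.rank d)
        (Function.update (s₂ (.rank d)) (some (ρ h)) (rnk d s₂ (ρ h) + 1))) x =
          if x = ρ h then h else lbl d s₂ x := by
      intro x
      simp only [lbl, Function.update_self, Function.update_apply, Option.some.injEq, ne_eq,
          reduceCtorEq, not_false_eq_true, Function.update_of_ne]
    have H := hU₂.link (L := L) hab hv hh (Or.inr ⟨hr', rfl⟩) (Or.inr rfl)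
      (fun x => by
        simp only [lnk, Function.update_self, Function.update_apply, Option.some.injEq, ne_eq,
          reduceCtorEq, not_false_eq_true, Function.update_of_ne])
      (fun x => by
        simp only [rnk, Function.update_self, Function.update_apply, Option.some.injEq]) hlbl
    refine ⟨fin _ _ (ρ h) H.1 (fun x hx => if_pos hx) (fun x hx => if_neg hx) hlbl,
      ((hF.write _ (by simp)).write _ (by simp)).write _ (by simp), ?_⟩
    have := H.2
    simp only [ne_eq, reduceCtorEq, not_false_eq_true, Function.update_of_ne, rnk] at this ⊢
    unfold opCost
    omega
  · have hlbl : ∀ x, lbl d (Function.update (Function.update s₂ (.link d)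
        (Function.update (s₂ (.link d)) (some (ρ v)) (ρ h))) (.label d)
        (Function.update (s₂ (.label d)) (some (ρ h)) h)) x =
          if x = ρ h then h else lbl d s₂ x := by
      intro x
      simp only [lbl, Function.update_self, Function.update_apply, Option.some.injEq]
    have H := hU₂.link (L := L) hab hv hh (Or.inl ⟨by omega, rfl⟩) (Or.inr rfl)
      (fun x => by
        simp only [lnk, Function.update_self, Function.update_apply, Option.some.injEq, ne_eq,
          reduceCtorEq, not_false_eq_true, Function.update_of_ne])
      (fun x => by
        simp only [rnk, ne_eq, reduceCtorEq, not_false_eq_true, Function.update_of_ne]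
        split
        · next e => rw [e]
        · rfl) hlbl
    refine ⟨fin _ _ (ρ h) H.1 (fun x hx => if_pos hx) (fun x hx => if_neg hx) hlbl,
      (hF.write _ (by simp)).write _ (by simp), ?_⟩
    have := H.2
    simp only [ne_eq, reduceCtorEq, not_false_eq_true, Function.update_of_ne] at this ⊢
    unfold opCost
    omega

/-! ## The phases of the main loop -/

theorem le_opCost (L : ℕ) : 30 ≤ opCost L := Nat.le_add_left _ _

theorem IsRep.frame {d : DSet} {σ : Fin n → Fin n} {A : List Arr} {s s' : Memory n}
    (h : IsRep d σ s) (hF : Frame A s s') (h1 : .link d ∉ A) (h2 : .rank d ∉ A)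
    (h3 : .label d ∉ A) : IsRep d σ s' := h.congr (hF _ h1) (hF _ h2) (hF _ h3)

theorem pot_frame {L : ℕ} {d : DSet} {A : List Arr} {s s' : Memory n} (hF : Frame A s s')
    (h1 : .link d ∉ A) (h2 : .rank d ∉ A) : pot L d s' = pot L d s :=
  pot_congr L (hF _ h1) (hF _ h2)

/-- The sources of the edges into `v` in the current graph. -/
def preds (s : Memory n) (v : Fin n) : List (Fin n) := s .pred (some v)

/-- The original edges that now target `v`. -/
def outs (s : Memory n) (v : Fin n) : List (Fin n × Fin n) := s .O (some v)

/-- The sources of the back edges into `v`. -/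
def backs (s : Memory n) (v : Fin n) : List (Fin n) := s .back (some v)

/-- The cross and forward edges that are stored at `h`. -/
def stored (s : Memory n) (h : Option (Fin n)) : List (Fin n × Fin n) := s .R h

/-- The amount of data attached to `v`. -/
def wt (s : Memory n) (v : Fin n) : ℕ := (preds s v).length + (outs s v).length + 1

theorem wt_frame {A : List Arr} {s s' : Memory n} (hF : Frame A s s') (h1 : .pred ∉ A)
    (h2 : .O ∉ A) : wt s' = wt s := by
  funext v
  simp only [wt, preds, outs, hF _ h1, hF _ h2]

/-- The common body of the three loops that add scheduling constraints. -/
theorem run_pushConstraint {L : ℕ} (hL : n ≤ hier L 1) (hL0 : 0 < L) {σ : Fin n → Fin n}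
    (u : Fin n) (y : Elem n) {s : Memory n} (h : IsRep .scc σ s) :
    Run (do
        let r ← rep .scc u
        let x ← read .exit r
        modify .fwd none (fun l => (x, y) :: l)) s fun _ s' t =>
      IsRep .scc σ s' ∧ Frame [.link .scc, .fwd] s s' ∧
        t + pot L .scc s' ≤ pot L .scc s + (opCost L + 3) := by
  simp only [run_bind, run_read, run_modify]
  refine (run_rep hL hL0 u h).mono ?_
  rintro _ s₁ t₁ ⟨rfl, h₁, hF₁, ht₁⟩
  have hF := (Frame.refl [.fwd] s₁).write (a := .fwd)
    (Function.update (s₁ .fwd) none ((s₁ .exit (some (σ u)), y) :: s₁ .fwd none)) (by simp)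
  refine ⟨h₁.frame hF (by simp) (by simp) (by simp), hF₁.trans hF (by simp) (by simp), ?_⟩
  · rw [pot_frame hF (by simp) (by simp)]
    omega

theorem run_addConstraints {L : ℕ} (hL : n ≤ hier L 1) (hL0 : 0 < L) {σ : Fin n → Fin n}
    (lift : Bool) (v : Fin n) {s : Memory n} (h : IsRep .scc σ s) :
    Run (addConstraints lift v) s fun _ s' t =>
      IsRep .scc σ s' ∧ Frame [.link .scc, .fwd] s s' ∧
        t + pot L .scc s' ≤ pot L .scc s + 2 * opCost L * wt s v := by
  have hU := le_opCost L
  simp only [addConstraints, run_bind, run_read]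
  let I := fun (γ : Type) (B : ℕ) (l : List γ) (s' : Memory n) (t : ℕ) =>
    IsRep .scc σ s' ∧ Frame [.link .scc, .fwd] s s' ∧
      t + pot L .scc s' + 2 * opCost L * l.length ≤ B
  refine run_forEach (I (Fin n × Fin n) (pot L .scc s + 2 * opCost L * (outs s v).length))
    ⟨h, Frame.refl _ _, by simp [outs]⟩ ?_ ?_
  · rintro ⟨u, v'⟩ l s₁ t₁ ⟨h₁, hF₁, ht₁⟩
    refine (run_pushConstraint hL hL0 u _ h₁).mono ?_
    rintro _ s₂ t₂ ⟨h₂, hF₂, ht₂⟩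
    refine ⟨h₂, hF₁.trans hF₂ (by simp) (by simp), ?_⟩
    simp only [List.length_cons] at ht₁
    linarith
  · rintro s₁ t₁ ⟨h₁, hF₁, ht₁⟩
    simp only [List.length_nil] at ht₁
    simp only [run_test, run_ite, run_bind, run_read, run_pure, decide_eq_true_eq]
    have hp : s₁ .pred = s .pred := hF₁ .pred (by simp)
    refine ⟨fun _ => ?_, fun _ => ⟨h₁, hF₁, ?_⟩⟩
    · refine run_forEach (I (Fin n) (pot L .scc s₁ + 2 * opCost L * (preds s v).length))
        ⟨h₁, hF₁, by simp [preds, hp]⟩ ?_ ?_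
      · rintro u l s₂ t₂ ⟨h₂, hF₂, ht₂⟩
        refine (run_pushConstraint hL hL0 u _ h₂).mono ?_
        rintro _ s₃ t₃ ⟨h₃, hF₃, ht₃⟩
        refine ⟨h₃, hF₂.trans hF₃ (by simp) (by simp), ?_⟩
        simp only [List.length_cons] at ht₂
        linarith
      · rintro s₂ t₂ ⟨h₂, hF₂, ht₂⟩
        refine ⟨h₂, hF₂, ?_⟩
        simp only [List.length_nil] at ht₂
        unfold wt
        linarith
    · have := Nat.zero_le (2 * opCost L * (preds s v).length)
      unfold wt
      linarith

/-- A restored edge adds one item to `pred` and one to `O` of a single vertex, so a total weighted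
by multiplicities at most 2 grows by at most 4. The multiplicities stay arbitrary, to be
instantiated with `credit`. -/
theorem run_restore {L : ℕ} (hL : n ≤ hier L 1) (hL0 : 0 < L) {σ : Fin n → Fin n}
    (h : Option (Fin n)) {s : Memory n} (hs : IsRep .scc σ s) :
    Run (restoreCrossForwardEdges h) s fun _ s' t =>
      IsRep .scc σ s' ∧ Frame [.link .scc, .pred, .O] s s' ∧
        (∀ c : Fin n → ℕ, (∀ v, c v ≤ 2) →
          ∑ v, c v * wt s' v ≤ ∑ v, c v * wt s v + 4 * (stored s h).length) ∧
        t + pot L .scc s' ≤ pot L .scc s + 2 * opCost L * ((stored s h).length + 1) := by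
  have hU := le_opCost L
  simp only [restoreCrossForwardEdges, run_bind, run_read]
  refine run_forEach (fun l s' t => IsRep .scc σ s' ∧ Frame [.link .scc, .pred, .O] s s' ∧
      (∀ c : Fin n → ℕ, (∀ v, c v ≤ 2) →
        ∑ v, c v * wt s' v + 4 * l.length ≤ ∑ v, c v * wt s v + 4 * (stored s h).length) ∧
      t + pot L .scc s' + 2 * opCost L * l.length ≤
        pot L .scc s + 2 * opCost L * (stored s h).length)
    ⟨hs, Frame.refl _ _, fun c _ => le_rfl, by simp [stored]⟩ ?_ ?_
  · rintro ⟨u, v⟩ l s₁ t₁ ⟨h₁, hF₁, hc₁, ht₁⟩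
    simp only [run_bind, run_modify]
    refine (run_rep hL hL0 v h₁).mono ?_
    rintro _ s₂ t₂ ⟨rfl, h₂, hF₂, ht₂⟩
    have hF := ((Frame.refl [.pred, .O] s₂).write (a := .pred)
      (Function.update (s₂ .pred) (some (σ v)) (u :: s₂ .pred (some (σ v)))) (by simp)).write
        (a := .O) (Function.update (s₂ .O) (some (σ v)) ((u, v) :: s₂ .O (some (σ v)))) (by simp)
    simp only [ne_eq, reduceCtorEq, not_false_eq_true, Function.update_of_ne] at hF ⊢
    refine ⟨h₂.frame hF (by simp) (by simp) (by simp), hF₁.trans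
      (hF₂.trans hF (A := [.link .scc, .pred, .O]) (by simp) (by simp)) (by simp) (by simp), ?_, ?_⟩
    · intro c hc
      have key : ∀ x, c x * wt (Function.update (Function.update s₂ .pred
          (Function.update (s₂ .pred) (some (σ v)) (u :: s₂ .pred (some (σ v))))) .O
          (Function.update (s₂ .O) (some (σ v)) ((u, v) :: s₂ .O (some (σ v))))) x ≤
          c x * wt s₁ x + if x = σ v then 4 else 0 := by
        intro x
        have hw : wt s₁ = wt s₂ := (wt_frame hF₂ (by simp) (by simp)).symm
        have := hc x
        rw [hw]
        by_cases hx : x = σ v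
        · subst hx
          simp only [wt, preds, outs, Function.update_self, if_true, ne_eq, reduceCtorEq,
            not_false_eq_true, Function.update_of_ne, List.length_cons]
          nlinarith
        · simp [wt, preds, outs, hx]
      have h4 := Finset.sum_le_sum fun x (_ : x ∈ Finset.univ) => key x
      rw [Finset.sum_add_distrib, Finset.sum_ite_eq' Finset.univ (σ v)] at h4
      simp only [Finset.mem_univ, if_true] at h4
      have := hc₁ c hc
      simp only [List.length_cons] at this
      omega
    · rw [pot_frame hF (by simp) (by simp)]
      simp only [List.length_cons] at ht₁
      linarith
  · rintro s₁ t₁ ⟨h₁, hF₁, hc₁, ht₁⟩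
    refine ⟨h₁, hF₁, hc₁, ?_⟩
    simp only [List.length_nil] at ht₁
    linarith

/-! ### The backward search and the round of a vertex -/

/-- The state of the search in round `h`: the lists `N` and `W` are the contents of memory, and
their items are distinct marked representatives. -/
structure Searching (h : Fin n) (σ : Fin n → Fin n) (N W : List (Fin n)) (s : Memory n) :
    Prop where
  rep : IsRep .scc σ s
  eqN : s .N none = N
  eqW : s .W none = W
  nodup : (N ++ W).Nodup
  marked : ∀ x ∈ N ++ W, σ x = x ∧ x ≠ h ∧ s .markW (some x) = some h

theorem Searching.push {h : Fin n} {σ : Fin n → Fin n} {N W : List (Fin n)} {s s' : Memory n}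
    (hS : Searching h σ N W s) {r : Fin n} (hσ : σ r = r) (hrh : r ≠ h)
    (hr : r ∉ N ++ W) {A : List Arr} (hF : Frame A s s')
    (h1 : .link .scc ∉ A) (h2 : .rank .scc ∉ A) (h3 : .label .scc ∉ A) (h4 : .N ∉ A)
    (hW : s' .W none = r :: W) (hm1 : s' .markW (some r) = some h)
    (hm2 : ∀ x, x ≠ r → s' .markW (some x) = s .markW (some x)) :
    Searching h σ N (r :: W) s' := by
  constructor
  · exact hS.rep.frame hF h1 h2 h3
  · rw [hF _ h4, hS.eqN]
  · exact hW
  · exact (List.perm_middle.nodup_iff).mpr (List.nodup_cons.mpr ⟨hr, hS.nodup⟩)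
  · intro x hx
    rcases List.mem_cons.mp ((List.perm_middle.mem_iff).mp hx) with rfl | hx
    · exact ⟨hσ, hrh, hm1⟩
    · rw [hm2 x (fun e => hr (e ▸ hx))]
      exact hS.marked x hx

/-- Each iteration moves an item to N, which has no repetitions, so n + 1 iterations suffice. Listed
items are marked, hence an unmarked one is new. The difference of the two sums charges only the
items moved during this call. -/
theorem run_searchBackwards {L : ℕ} (hL : n ≤ hier L 1) (hL0 : 0 < L) {σ : Fin n → Fin n}
    (h : Fin n) (k : ℕ) {N W : List (Fin n)} {s : Memory n} (hs : Searching h σ N W s)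
    (hk : n + 1 ≤ k + N.length) :
    Run (searchBackwards h k) s fun _ s' t => ∃ N', Searching h σ N' [] s' ∧
        (W = [] → N' = N) ∧ Frame [.link .scc, .N, .W, .markW] s s' ∧
        t + pot L .scc s' + 2 * opCost L * (N.map (wt s)).sum ≤
          pot L .scc s + 2 * opCost L * ((N'.map (wt s)).sum + 1) := by
  have hU := le_opCost L
  induction k generalizing N W s with
  | zero =>
    have := (List.Nodup.of_append_left hs.nodup).length_le_card
    simp only [Fintype.card_fin] at this
    omega
  | succ k ih =>
    simp only [searchBackwards, run_bind, run_read]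
    rw [show s .W none = W from hs.eqW]
    cases W with
    | nil =>
      simp only [run_pure]
      exact ⟨N, hs, fun _ => rfl, Frame.refl _ _, by linarith⟩
    | cons v rest =>
      simp only [run_bind, run_write, run_modify, run_read]
      generalize hs₀ : Function.update _ Arr.N _ = s₀
      have hF₀ : Frame [.W, .N] s s₀ := by
        rw [← hs₀]
        exact ((Frame.refl _ _).write _ (by simp)).write _ (by simp)
      have hperm : ((v :: N) ++ rest).Perm (N ++ v :: rest) := List.perm_middle.symm
      have hS₀ : Searching h σ (v :: N) rest s₀ := by
        constructor
        · exact hs.rep.frame hF₀ (by simp) (by simp) (by simp)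
        · have := hs.eqN
          simp [← hs₀, this]
        · simp [← hs₀]
        · exact hperm.nodup_iff.mpr hs.nodup
        · intro x hx
          rw [hF₀ .markW (by simp)]
          exact hs.marked x (hperm.mem_iff.mp hx)
      have hp₀ : s₀ .pred (some v) = preds s v := by
        simp only [preds, hF₀ .pred (by simp)]
      rw [hp₀]
      refine run_forEach (fun l s' t => ∃ W', Searching h σ (v :: N) W' s' ∧
        Frame [.link .scc, .N, .W, .markW] s s' ∧
        t + pot L .scc s' + 2 * opCost L * l.length ≤
          pot L .scc s + 2 * opCost L * (preds s v).length) ⟨rest, hS₀, ?_, ?_⟩ ?_ ?_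
      · exact hF₀.trans (Frame.refl [] _) (by simp) (by simp)
      · rw [pot_frame hF₀ (by simp) (by simp)]
        omega
      · rintro p l s₁ t₁ ⟨W', hS₁, hF₁, ht₁⟩
        simp only [List.length_cons] at ht₁
        simp only [run_bind]
        refine (run_rep hL hL0 p hS₁.rep).mono ?_
        rintro _ s₂ t₂ ⟨rfl, hR₂, hF₂, ht₂⟩
        have hS₂ : Searching h σ (v :: N) W' s₂ :=
          ⟨hR₂, by rw [hF₂ .N (by simp), hS₁.eqN], by rw [hF₂ .W (by simp), hS₁.eqW], hS₁.nodup,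
            by rw [hF₂ .markW (by simp)]; exact hS₁.marked⟩
        have hF₂' := hF₁.trans hF₂ (A := [.link .scc, .N, .W, .markW]) (by simp) (by simp)
        simp only [run_test, run_ite, run_bind, run_read, run_pure, run_write, run_modify,
          decide_eq_true_eq]
        refine ⟨fun hc => ⟨σ p :: W', ?_, ?_, ?_⟩, fun _ => ⟨W', hS₂, hF₂', by linarith⟩⟩
        · have hF₃ := ((Frame.refl [.markW, .W] s₂).write (a := .markW)
            (Function.update (s₂ .markW) (some (σ p)) (some h)) (by simp)).write (a := .W)
            (Function.update (s₂ .W) none (σ p :: s₂ .W none)) (by simp)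
          refine hS₂.push (hR₂.idem p) hc.1 (fun hx => hc.2 (hS₂.marked _ hx).2.2) hF₃
            (by simp) (by simp) (by simp) (by simp) ?_ ?_ ?_
          · have := hS₂.eqW
            simp [this]
          · simp
          · intro x hx
            simp [hx]
        · exact (hF₂'.write _ (by simp)).write _ (by simp)
        · rw [pot_congr L (s := s₂) (by simp) (by simp)]
          linarith
      · rintro s₁ t₁ ⟨W', hS₁, hF₁, ht₁⟩
        simp only [List.length_nil] at ht₁
        refine (ih hS₁ (by simp only [List.length_cons]; omega)).mono ?_
        rintro _ s₂ t₂ ⟨N', hS₂, -, hF₂, ht₂⟩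
        refine ⟨N', hS₂, by simp, hF₁.trans hF₂ (by simp) (by simp), ?_⟩
        rw [wt_frame hF₁ (by simp) (by simp)] at ht₂
        simp only [List.map_cons, List.sum_cons] at ht₂
        -- The summand 1 in `wt` pays for taking `v` from the worklist.
        have h5 : 2 * opCost L * (preds s v).length + 2 * opCost L ≤ 2 * opCost L * wt s v := by
          rw [wt, ← Nat.mul_succ]
          exact Nat.mul_le_mul_left _ (by omega)
        linarith

/-- The worklist starts as a part of P, so N is empty when P is. That is the case in which the round
ends without merging N. -/
theorem run_findNestedSCCs {L : ℕ} (hL : n ≤ hier L 1) (hL0 : 0 < L) {σ : Fin n → Fin n}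
    (h : Fin n) {s : Memory n} (hs : IsRep .scc σ s) :
    Run (findNestedSCCs h) s fun _ s' t => ∃ N P : List (Fin n), Searching h σ N [] s' ∧
        s' .P none = P ∧ P.length ≤ (backs s h).length ∧ (P = [] → N = []) ∧
        Frame [.link .scc, .P, .N, .W, .markP, .markW] s s' ∧
        t + pot L .scc s' ≤
          pot L .scc s + 2 * opCost L * ((N.map (wt s)).sum + (backs s h).length + 2) := by
  have hU := le_opCost L
  simp only [findNestedSCCs, run_bind, run_read, run_write]
  generalize hs₀ : Function.update _ Arr.W _ = s₀
  have hF₀ : Frame [.P, .N, .W] s s₀ := by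
    rw [← hs₀]
    exact (((Frame.refl _ _).write _ (by simp)).write _ (by simp)).write _ (by simp)
  have hb₀ : s₀ .back (some h) = backs s h := by
    simp only [backs, hF₀ .back (by simp)]
  rw [hb₀]
  refine run_forEach (fun l s' t => ∃ W P : List (Fin n), Searching h σ [] W s' ∧
    s' .P none = P ∧ P.length + l.length ≤ (backs s h).length ∧ (P = [] → W = []) ∧
    (∀ x ∈ W, s' .markP (some x) = some h) ∧
    Frame [.link .scc, .P, .N, .W, .markP, .markW] s s' ∧
    t + pot L .scc s' + 2 * opCost L * l.length ≤
      pot L .scc s + 2 * opCost L * (backs s h).length)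
    ⟨[], [], ⟨hs.frame hF₀ (by simp) (by simp) (by simp), ?_, ?_, ?_, ?_⟩, ?_, ?_, ?_, ?_, ?_, ?_⟩
    ?_ ?_
  · simp [← hs₀]
  · simp [← hs₀]
  · simp
  · simp
  · simp [← hs₀]
  · simp
  · simp
  · simp
  · exact hF₀.trans (Frame.refl [] _) (by simp) (by simp)
  · rw [pot_frame hF₀ (by simp) (by simp)]
    omega
  · rintro p l s₁ t₁ ⟨W, P, hS₁, hP₁, hl₁, hPW₁, hm₁, hF₁, ht₁⟩
    simp only [List.length_cons] at ht₁ hl₁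
    simp only [run_bind]
    refine (run_rep hL hL0 p hS₁.rep).mono ?_
    rintro _ s₂ t₂ ⟨rfl, hR₂, hF₂, ht₂⟩
    have hS₂ : Searching h σ [] W s₂ :=
      ⟨hR₂, by rw [hF₂ .N (by simp), hS₁.eqN], by rw [hF₂ .W (by simp), hS₁.eqW], hS₁.nodup,
        by rw [hF₂ .markW (by simp)]; exact hS₁.marked⟩
    have hP₂ : s₂ .P none = P := by rw [hF₂ .P (by simp), hP₁]
    have hF₂' := hF₁.trans hF₂ (A := [.link .scc, .P, .N, .W, .markP, .markW])
      (by simp) (by simp)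
    have hm₂ : ∀ x ∈ W, s₂ .markP (some x) = some h := by
      rw [hF₂ .markP (by simp)]
      exact hm₁
    simp only [run_test, run_ite, run_bind, run_read, run_pure, run_write, run_modify,
      decide_eq_true_eq]
    refine ⟨fun hc => ?_, fun _ => ⟨W, P, hS₂, hP₂, by omega, hPW₁, hm₂, hF₂', by linarith⟩⟩
    -- Members of W carry the mark of P too, so an item without that mark is not among them.
    have hrW : σ p ∉ [] ++ W := fun hx => hc (hm₂ _ hx)
    generalize hs₃ : Function.update _ Arr.P _ = s₃
    have hF₃ : Frame [.markP, .P] s₂ s₃ := by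
      rw [← hs₃]
      exact ((Frame.refl _ _).write _ (by simp)).write _ (by simp)
    have hP₃ : s₃ .P none = σ p :: P := by simp [← hs₃, ← hP₂]
    have hm₃ : ∀ x, s₃ .markP (some x) = if x = σ p then some h else s₂ .markP (some x) := by
      intro x
      simp [← hs₃, Function.update_apply]
    have hF₃' := hF₂'.trans hF₃ (A := [.link .scc, .P, .N, .W, .markP, .markW])
      (by simp) (by simp)
    have hS₃ : Searching h σ [] W s₃ :=
      ⟨hR₂.frame hF₃ (by simp) (by simp) (by simp), by rw [hF₃ .N (by simp), hS₂.eqN],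
        by rw [hF₃ .W (by simp), hS₂.eqW], hS₂.nodup,
        by rw [hF₃ .markW (by simp)]; exact hS₂.marked⟩
    have hpot := pot_frame (L := L) (d := .scc) hF₃ (by simp) (by simp)
    have hmW : ∀ x ∈ W, s₃ .markP (some x) = some h := by
      intro x hx
      rw [hm₃]
      split
      · rfl
      · exact hm₂ x hx
    refine ⟨fun hph => ⟨σ p :: W, σ p :: P, ?_, ?_, ?_, by simp, ?_, ?_, ?_⟩,
      fun _ => ⟨W, σ p :: P, hS₃, hP₃, ?_, by simp, hmW, hF₃', ?_⟩⟩
    · have hF₄ := ((Frame.refl [.markW, .W] s₃).write (a := .markW)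
        (Function.update (s₃ .markW) (some (σ p)) (some h)) (by simp)).write (a := .W)
        (Function.update (s₃ .W) none (σ p :: s₃ .W none)) (by simp)
      refine hS₃.push (hR₂.idem p) hph hrW hF₄ (by simp) (by simp) (by simp) (by simp) ?_ ?_ ?_
      · have := hS₃.eqW
        simp [this]
      · simp
      · intro x hx
        simp [hx]
    · simp [hP₃]
    · simp only [List.length_cons]
      omega
    · intro x hx
      rw [Function.update_of_ne (by simp), Function.update_of_ne (by simp)]
      rcases List.mem_cons.mp hx with rfl | hx
      · rw [hm₃, if_pos rfl]
      · exact hmW x hx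
    · exact (hF₃'.write _ (by simp)).write _ (by simp)
    · rw [pot_congr L (s := s₃) (by simp) (by simp)]
      linarith
    · simp only [List.length_cons]
      omega
    · linarith
  · rintro s₁ t₁ ⟨W, P, hS₁, hP₁, hl₁, hPW₁, -, hF₁, ht₁⟩
    simp only [List.length_nil] at ht₁ hl₁
    refine (run_searchBackwards hL hL0 h (n + 1) hS₁ (by simp)).mono ?_
    rintro _ s₂ t₂ ⟨N, hS₂, hN, hF₂, ht₂⟩
    refine ⟨N, P, hS₂, ?_, by omega, fun hP => hN (hPW₁ hP), hF₁.trans hF₂ (by simp) (by simp), ?_⟩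
    · rw [hF₂ .P (by simp), hP₁]
    · rw [wt_frame hF₁ (by simp) (by simp)] at ht₂
      simp only [List.map_nil, List.sum_nil] at ht₂
      linarith

/-- Per unit of weight on N, the search costs 2, connecting 3 and merging 2, rounded up to 8; per
back edge, 2 for the search and 2 for the constraint into the exit. That no member of N remains a
representative is what allows its weight to be charged to released credit. -/
theorem run_constructWPOForSCC {L : ℕ} (hL : n ≤ hier L 1) (hL0 : 0 < L) {σ : Fin n → Fin n}
    (lift : Bool) (h : Fin n) {s : Memory n} (hs : IsRep .scc σ s) :
    Run (constructWPOForSCC lift h) s fun _ s' t => ∃ (σ' : Fin n → Fin n) (N : List (Fin n)),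
        IsRep .scc σ' s' ∧ N.Nodup ∧ (∀ x ∈ N, σ x = x ∧ x ≠ h) ∧
        (∀ x, σ' x = x → x = h ∨ σ x = x ∧ x ∉ N) ∧
        Frame [.link .scc, .rank .scc, .label .scc, .P, .N, .W, .markP, .markW, .fwd, .bwd, .X,
          .exit] s s' ∧
        t + pot L .scc s' ≤ pot L .scc s +
          opCost L * (8 * (N.map (wt s)).sum + 4 * (backs s h).length + 8) := by
  have hU := le_opCost L
  simp only [constructWPOForSCC, run_bind, run_read]
  refine (run_findNestedSCCs hL hL0 h hs).mono ?_
  rintro _ s₁ t₁ ⟨N, P, hS₁, hP₁, hl₁, hPN, hF₁, ht₁⟩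
  have hN : N.Nodup := List.Nodup.of_append_left hS₁.nodup
  have hNr : ∀ x ∈ N, σ x = x ∧ x ≠ h := fun x hx =>
    have := hS₁.marked x (List.mem_append_left _ hx)
    ⟨this.1, this.2.1⟩
  simp only [run_test, run_ite, run_bind, run_pure, run_write, run_modify,
    decide_eq_true_eq]
  rw [show s₁ .P none = P from hP₁, show s₁ .N none = N from hS₁.eqN, List.isEmpty_iff]
  refine ⟨fun hP => ⟨σ, N, hS₁.rep, hN, hNr, fun x hx => Or.inr ⟨hx, ?_⟩,
    hF₁.trans (Frame.refl [] _) (by simp) (by simp), ?_⟩, fun _ => ?_⟩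
  · simp [hPN hP]
  · nlinarith [Nat.zero_le (opCost L * (N.map (wt s)).sum),
      Nat.zero_le (opCost L * (backs s h).length)]
  refine run_forEach (fun l s' t => IsRep .scc σ s' ∧ Frame [.link .scc, .fwd] s₁ s' ∧
    t + pot L .scc s' + 3 * opCost L * (l.map (wt s)).sum ≤
      pot L .scc s₁ + 3 * opCost L * (N.map (wt s)).sum)
    ⟨hS₁.rep, Frame.refl _ _, by omega⟩ ?_ ?_
  · rintro v l s₂ t₂ ⟨h₂, hF₂, ht₂⟩
    refine (run_addConstraints hL hL0 lift v h₂).mono ?_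
    rintro _ s₃ t₃ ⟨h₃, hF₃, ht₃⟩
    refine ⟨h₃, hF₂.trans hF₃ (by simp) (by simp), ?_⟩
    have hw : wt s₂ = wt s :=
      (wt_frame hF₂ (by simp) (by simp)).trans (wt_frame hF₁ (by simp) (by simp))
    simp only [List.map_cons, List.sum_cons] at ht₂
    rw [hw] at ht₃
    have : 1 ≤ opCost L * wt s v := Nat.mul_pos (by omega) (Nat.succ_pos _)
    nlinarith
  rintro s₂ t₂ ⟨h₂, hF₂, ht₂⟩
  simp only [List.map_nil, List.sum_nil] at ht₂
  generalize hs₃ : Function.update s₂ Arr.X _ = s₃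
  have hF₃ : Frame [.X] s₂ s₃ := by
    rw [← hs₃]
    exact (Frame.refl _ _).write _ (by simp)
  have h₃ := h₂.frame hF₃ (by simp) (by simp) (by simp)
  have hp₃ := pot_frame (L := L) (d := .scc) hF₃ (by simp) (by simp)
  refine run_forEach (fun l s' t => IsRep .scc σ s' ∧ Frame [.link .scc, .fwd] s₃ s' ∧
    t + pot L .scc s' + 2 * opCost L * l.length ≤ pot L .scc s₃ + 2 * opCost L * P.length)
    ⟨h₃, Frame.refl _ _, by omega⟩ ?_ ?_
  · rintro p l s₄ t₄ ⟨h₄, hF₄, ht₄⟩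
    refine (run_pushConstraint hL hL0 p _ h₄).mono ?_
    rintro _ s₅ t₅ ⟨h₅, hF₅, ht₅⟩
    refine ⟨h₅, hF₄.trans hF₅ (by simp) (by simp), ?_⟩
    simp only [List.length_cons] at ht₄
    linarith
  rintro s₄ t₄ ⟨h₄, hF₄, ht₄⟩
  simp only [List.length_nil] at ht₄
  generalize hs₅ : Function.update _ Arr.exit _ = s₅
  have hF₅ : Frame [.bwd, .exit] s₄ s₅ := by
    rw [← hs₅]
    exact ((Frame.refl _ _).write _ (by simp)).write _ (by simp)
  have h₅ := h₄.frame hF₅ (by simp) (by simp) (by simp)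
  have hp₅ := pot_frame (L := L) (d := .scc) hF₅ (by simp) (by simp)
  -- Members of N are merged one at a time: one that is still a representative is on the remaining
  -- list.
  refine run_forEach (fun l s' t => (∃ (σ' : Fin n → Fin n), IsRep .scc σ' s' ∧
      (∀ x, σ' x = x → x = h ∨ σ x = x ∧ (x ∈ N → x ∈ l))) ∧
    Frame [.link .scc, .rank .scc, .label .scc] s₅ s' ∧
    t + pot L .scc s' + 2 * opCost L * l.length ≤ pot L .scc s₅ + 2 * opCost L * N.length)
    ⟨⟨σ, h₅, fun x hx => Or.inr ⟨hx, id⟩⟩, Frame.refl _ _, by omega⟩ ?_ ?_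
  · rintro v l s₆ t₆ ⟨⟨σ₆, h₆, hσ₆⟩, hF₆, ht₆⟩
    refine (run_merge hL hL0 v h h₆).mono ?_
    rintro _ s₇ t₇ ⟨⟨σ₇, h₇, hσ₇⟩, hF₇, ht₇⟩
    refine ⟨⟨σ₇, h₇, fun x hx => ?_⟩, hF₆.trans hF₇ (by simp) (by simp), ?_⟩
    · rcases hσ₇ x hx with e | ⟨hx₆, hxv⟩
      · exact Or.inl e
      · rcases hσ₆ x hx₆ with e | ⟨hx, hxl⟩
        · exact Or.inl e
        · exact Or.inr ⟨hx, fun hxN => (List.mem_cons.mp (hxl hxN)).resolve_left hxv⟩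
    · simp only [List.length_cons] at ht₆
      linarith
  · rintro s₆ t₆ ⟨⟨σ₆, h₆, hσ₆⟩, hF₆, ht₆⟩
    refine ⟨σ₆, N, h₆, hN, hNr, fun x hx => (hσ₆ x hx).imp_right
      fun ⟨hx, hxN⟩ => ⟨hx, fun hx => by simpa using hxN hx⟩, ?_, ?_⟩
    · intro a ha
      simp only [List.mem_cons, List.not_mem_nil, or_false, not_or] at ha
      rw [hF₆ a (by simp [ha]), hF₅ a (by simp [ha]), hF₄ a (by simp [ha]), hF₃ a (by simp [ha]),
        hF₂ a (by simp [ha]), hF₁ a (by simp [ha])]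
    · simp only [List.length_nil] at ht₆
      have hNl : N.length ≤ (N.map (wt s)).sum := by
        have := List.sum_le_sum (l := N) (f := fun _ => 1) (g := wt s) fun v _ => Nat.succ_pos _
        simpa using this
      have e1 := Nat.mul_le_mul_left (opCost L) hNl
      have e2 := Nat.mul_le_mul_left (opCost L) hl₁
      nlinarith

/-! ### Credit accounting over all rounds -/

/-- The number of times that the data of `v` may still be traversed when the vertices in `vs` remain. -/
def credit (σ : Fin n → Fin n) (vs : List (Fin n)) (v : Fin n) : ℕ :=
  (if σ v = v then 1 else 0) + if v ∈ vs then 1 else 0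

theorem credit_le (σ : Fin n → Fin n) (vs : List (Fin n)) (v : Fin n) : credit σ vs v ≤ 2 := by
  unfold credit
  split <;> split <;> omega

/-- Each member of N loses its unit for being a representative. Should `h` become one, the unit for
its pending round, now released, pays; so it need not be known whether `h` was a representative
before. -/
theorem credit_add_le {σ σ' : Fin n → Fin n} {h : Fin n} {N l : List (Fin n)}
    (hN : ∀ x ∈ N, σ x = x ∧ x ≠ h) (hσ : ∀ x, σ' x = x → x = h ∨ σ x = x ∧ x ∉ N)
    (hl : h ∉ l) (v : Fin n) :
    credit σ' l v + (if v ∈ N then 1 else 0) ≤ credit σ (h :: l) v := by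
  unfold credit
  by_cases hv : v = h
  · subst hv
    have : v ∉ N := fun hv => (hN v hv).2 rfl
    simp only [hl, this, if_false, List.mem_cons_self, if_true]
    split <;> omega
  · have hm : v ∈ h :: l ↔ v ∈ l := by simp [hv]
    simp only [hm]
    by_cases hvN : v ∈ N
    · have h1 := (hN v hvN).1
      have h2 : σ' v ≠ v := fun e => by
        rcases hσ v e with e | e
        · exact hv e
        · exact e.2 hvN
      simp only [h1, h2, hvN, if_true, if_false]
      omega
    · by_cases h1 : σ' v = v
      · have h2 : σ v = v := ((hσ v h1).resolve_left hv).1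
        simp [h1, h2, hvN]
      · simp [h1, hvN]

/-- The potential is 8 `opCost L` times the weight counted with credit. A restored edge raises that
weighted total by at most 4, which uses 32 of the coefficient 40; the rest covers the direct costs
of restored edges, back edges and rounds. -/
theorem run_mainLoop {L : ℕ} (hL : n ≤ hier L 1) (hL0 : 0 < L) {σ : Fin n → Fin n}
    (lift : Bool) {vs : List (Fin n)} (hvs : vs.Nodup) {s : Memory n} (hs : IsRep .scc σ s) :
    Run (forEach vs fun h => do
        restoreCrossForwardEdges (some h)
        constructWPOForSCC lift h) s fun _ s' t => ∃ σ' : Fin n → Fin n, IsRep .scc σ' s' ∧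
      s' .R = s .R ∧ t + pot L .scc s' + 8 * opCost L * ∑ v, credit σ' [] v * wt s' v ≤
        pot L .scc s + 8 * opCost L * ∑ v, credit σ vs v * wt s v + 1 +
          40 * opCost L *
            (vs.map fun v => (backs s v).length + (stored s (some v)).length + 1).sum := by
  have hU := le_opCost L
  refine run_forEach (fun l s' t => l.Nodup ∧ s' .R = s .R ∧ s' .back = s .back ∧
    ∃ σ' : Fin n → Fin n, IsRep .scc σ' s' ∧
      t + pot L .scc s' + 8 * opCost L * ∑ v, credit σ' l v * wt s' v +
          40 * opCost L *
            (l.map fun v => (backs s v).length + (stored s (some v)).length + 1).sum ≤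
        pot L .scc s + 8 * opCost L * ∑ v, credit σ vs v * wt s v +
          40 * opCost L *
            (vs.map fun v => (backs s v).length + (stored s (some v)).length + 1).sum)
    ⟨hvs, rfl, rfl, σ, hs, by omega⟩ ?_ ?_
  · rintro h l s₁ t₁ ⟨hl, hR₁, hB₁, σ₁, h₁, ht₁⟩
    simp only [run_bind]
    refine (run_restore hL hL0 (some h) h₁).mono ?_
    rintro _ s₂ t₂ ⟨h₂, hF₂, hc₂, ht₂⟩
    refine (run_constructWPOForSCC hL hL0 lift h h₂).mono ?_
    rintro _ s₃ t₃ ⟨σ₃, N, h₃, hN, hNr, hσ₃, hF₃, ht₃⟩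
    refine ⟨(List.nodup_cons.mp hl).2, ?_, ?_, σ₃, h₃, ?_⟩
    · rw [hF₃ .R (by simp), hF₂ .R (by simp), hR₁]
    · rw [hF₃ .back (by simp), hF₂ .back (by simp), hB₁]
    · have hb : backs s₂ h = backs s h := by
        simp only [backs, hF₂ .back (by simp), hB₁]
      have hst : stored s₁ (some h) = stored s (some h) := by
        simp only [stored, hR₁]
      have hw : wt s₃ = wt s₂ := wt_frame hF₃ (by simp) (by simp)
      have hc := hc₂ (credit σ₁ (h :: l)) (credit_le _ _)
      have hkey : ∑ v, credit σ₃ l v * wt s₃ v + (N.map (wt s₂)).sum ≤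
          ∑ v, credit σ₁ (h :: l) v * wt s₂ v := by
        have hsum : (N.map (wt s₂)).sum = ∑ v, if v ∈ N.toFinset then wt s₂ v else 0 := by
          rw [Finset.sum_ite_mem, Finset.univ_inter, List.sum_toFinset _ hN]
        rw [hsum, hw, ← Finset.sum_add_distrib]
        refine Finset.sum_le_sum fun v _ => ?_
        have := credit_add_le (fun x hx => hNr x hx) hσ₃ (List.nodup_cons.mp hl).1 v
        simp only [List.mem_toFinset]
        split
        · next hv =>
          rw [if_pos hv] at this
          calc _ = (credit σ₃ l v + 1) * wt s₂ v := by ring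
            _ ≤ _ := Nat.mul_le_mul_right _ this
        · next hv =>
          rw [if_neg hv] at this
          exact Nat.mul_le_mul_right _ this
      rw [hb] at ht₃
      rw [hst] at ht₂ hc
      simp only [List.map_cons, List.sum_cons] at ht₁
      have e1 := Nat.mul_le_mul_left (opCost L) (hkey.trans hc)
      nlinarith
  · rintro s₁ t₁ ⟨-, hR₁, -, σ₁, h₁, ht₁⟩
    simp only [List.map_nil, List.sum_nil] at ht₁
    exact ⟨σ₁, h₁, hR₁, by omega⟩

/-- With no round left, the credit is the indicator of the representatives, exactly the vertices
connected here. -/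
theorem run_connectWPOsOfMaximalSCCs {L : ℕ} (hL : n ≤ hier L 1) (hL0 : 0 < L)
    {σ : Fin n → Fin n} (lift : Bool) {s : Memory n} (hs : IsRep .scc σ s) :
    Run (connectWPOsOfMaximalSCCs lift) s fun _ _ t =>
      t ≤ pot L .scc s + 2 * opCost L * ∑ v, credit σ [] v * wt s v + 1 + 2 * opCost L * n := by
  have hU := le_opCost L
  refine run_forEach (fun l s' t => IsRep .scc σ s' ∧ Frame [.link .scc, .fwd] s s' ∧
    t + pot L .scc s' + 2 * opCost L * (l.map fun v => credit σ [] v * wt s v).sum +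
        2 * opCost L * l.length ≤
      pot L .scc s + 2 * opCost L * ∑ v, credit σ [] v * wt s v + 2 * opCost L * n)
    ⟨hs, Frame.refl _ _, ?_⟩ ?_ ?_
  · rw [← Fin.sum_univ_def, List.length_finRange]
    omega
  · rintro v l s₁ t₁ ⟨h₁, hF₁, ht₁⟩
    simp only [List.map_cons, List.sum_cons, List.length_cons] at ht₁
    simp only [run_bind]
    refine (run_rep hL hL0 v h₁).mono ?_
    rintro _ s₂ t₂ ⟨rfl, h₂, hF₂, ht₂⟩
    have hF := hF₁.trans hF₂ (A := [.link .scc, .fwd]) (by simp) (by simp)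
    simp only [run_test, run_ite, run_pure, decide_eq_true_eq]
    refine ⟨fun hv => (run_addConstraints hL hL0 lift v h₂).mono ?_, fun _ => ⟨h₂, hF, ?_⟩⟩
    · rintro _ s₃ t₃ ⟨h₃, hF₃, ht₃⟩
      refine ⟨h₃, hF.trans hF₃ (by simp) (by simp), ?_⟩
      rw [wt_frame hF (by simp) (by simp)] at ht₃
      have hc : credit σ [] v = 1 := by simp [credit, hv]
      rw [hc] at ht₁
      linarith
    · have := Nat.zero_le (2 * opCost L * (credit σ [] v * wt s v))
      linarith
  · rintro s₁ t₁ ⟨-, -, ht₁⟩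
    simp only [List.map_nil, List.sum_nil, List.length_nil] at ht₁
    omega

/-! ## The preparatory phases -/

/-- The vertices of a forest, in preorder. -/
def Forest.verts {V : Type} : Forest V → List V
  | .nil => []
  | .node r children siblings => r :: (children.verts ++ siblings.verts)

/-- A vertex is entered only while undiscovered and stays discovered. Thus the traversal meets at
most n nodes, and every vertex has at most one round. -/
theorem DFS.verts_nodup {V : Type} {E : V → V → Prop} {cand S S' : Set V} {F : Forest V}
    (h : DFS E cand S F S') :
    F.verts.Nodup ∧ (∀ x ∈ F.verts, x ∉ S ∧ x ∈ S') ∧ S ⊆ S' := by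
  induction h with
  | done _ => exact ⟨List.nodup_nil, by simp [Forest.verts], subset_rfl⟩
  | visit _ hr _ _ ih₁ ih₂ =>
    obtain ⟨hn₁, hv₁, hs₁⟩ := ih₁
    obtain ⟨hn₂, hv₂, hs₂⟩ := ih₂
    have hrS := hs₁ (Set.mem_insert _ _)
    refine ⟨?_, ?_, (Set.subset_insert _ _).trans (hs₁.trans hs₂)⟩
    · rw [Forest.verts, List.nodup_cons, List.nodup_append']
      refine ⟨fun hm => ?_, hn₁, hn₂, fun x h1 h2 => (hv₂ x h2).1 (hv₁ x h1).2⟩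
      rcases List.mem_append.mp hm with hm | hm
      · exact (hv₁ _ hm).1 (Set.mem_insert _ _)
      · exact (hv₂ _ hm).1 hrS
    · intro x hx
      rcases List.mem_cons.mp hx with rfl | hx
      · exact ⟨hr, hs₂ hrS⟩
      · rcases List.mem_append.mp hx with hx | hx
        · exact ⟨fun h => (hv₁ x hx).1 (Set.mem_insert_of_mem _ h), hs₂ (hv₁ x hx).2⟩
        · exact ⟨fun h => (hv₂ x hx).1 (hs₁ (Set.mem_insert_of_mem _ h)), (hv₂ x hx).2⟩

/-- Nine steps per node and one per empty subforest, of which there is one more than there are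
nodes. -/
theorem run_tabulate (F : Forest (Fin n)) (p : Option (Fin n)) (s : Memory n) :
    Run (tabulate F p) s fun _ s' t => Frame [.dfn, .post, .parent, .clock, .order] s s' ∧
      s' .order none = F.verts.reverse ++ (s .order none : List (Fin n)) ∧
      t = 10 * F.verts.length + 1 := by
  induction F generalizing p s with
  | nil =>
    simp only [tabulate, run_tick]
    exact ⟨Frame.refl _ _, rfl, rfl⟩
  | node r c b ih₁ ih₂ =>
    simp only [tabulate, run_bind, run_read, run_write, run_modify]
    generalize hs₁ : Function.update _ Arr.order _ = s₁
    have hF₁ : Frame [.dfn, .post, .parent, .clock, .order] s s₁ := by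
      rw [← hs₁]
      exact ((((Frame.refl _ _).write _ (by simp)).write _ (by simp)).write _ (by simp)).write _
        (by simp)
    have ho₁ : s₁ .order none = r :: (s .order none : List (Fin n)) := by simp [← hs₁]
    refine (ih₁ _ s₁).mono ?_
    rintro _ s₂ t₂ ⟨hF₂, ho₂, rfl⟩
    generalize hs₃ : Function.update _ Arr.clock _ = s₃
    have hF₃ : Frame [.post, .clock] s₂ s₃ := by
      rw [← hs₃]
      exact ((Frame.refl _ _).write _ (by simp)).write _ (by simp)
    refine (ih₂ _ s₃).mono ?_
    rintro _ s₄ t₄ ⟨hF₄, ho₄, rfl⟩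
    refine ⟨?_, ?_, ?_⟩
    · refine (hF₁.trans hF₂ (A := [.dfn, .post, .parent, .clock, .order]) (by simp)
        (by simp)).trans (hF₃.trans hF₄ (A := [.dfn, .post, .parent, .clock, .order]) (by simp)
        (by simp)) (by simp) (by simp)
    · rw [ho₄, hF₃ .order (by simp), ho₂, ho₁]
      simp [Forest.verts]
    · simp only [Forest.verts, List.length_cons, List.length_append]
      ring

/-- The cells of `v` are in their initial state. -/
structure IsInit (s : Memory n) (v : Fin n) : Prop where
  lnk_eq : ∀ d, lnk d s v = v
  rnk_eq : ∀ d, rnk d s v = 0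
  lbl_eq : ∀ d, lbl d s v = v
  backs_eq : backs s v = []
  preds_eq : preds s v = []
  outs_eq : outs s v = []
  stored_eq : stored s (some v) = []
  query_eq : s .query (some v) = []

theorem IsInit.isRep {s : Memory n} (h : ∀ v, IsInit s v) (d : DSet) : IsRep d id s := by
  refine ⟨id, ⟨fun x hx => absurd ((h x).lnk_eq d) hx, fun x => ?_, ?_, fun x => (h x).lnk_eq d,
    fun x => (h x).lnk_eq d, fun x _ => rfl, fun x => (h x).lbl_eq d⟩,
    fun x => ((h x).lbl_eq d).symm⟩
  · rw [(h x).rnk_eq d]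
    exact x.pos
  · simp [(h _).lnk_eq d, (h _).rnk_eq d]

/-- All ranks are 0, and rank 0 has no pairs. -/
theorem IsInit.pot {s : Memory n} (h : ∀ v, IsInit s v) (L : ℕ) (d : DSet) : pot L d s = 0 := by
  simp [WPO.pot, phi, (h _).rnk_eq d]

theorem run_setup (D : Forest (Fin n)) (s : Memory n) :
    Run (setup D) s fun _ s' t => (∀ v, IsInit s' v) ∧ stored s' none = [] ∧
      s' .cross none = [] ∧ s' .order none = D.verts.reverse ∧
      t = 10 * D.verts.length + 15 * n + 9 := by
  simp only [setup, run_bind, run_write]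
  generalize hs₁ : Function.update _ Arr.order _ = s₁
  have hR₁ : stored s₁ none = [] := by simp [← hs₁, stored]
  have hc₁ : s₁ .cross none = [] := by simp [← hs₁]
  have ho₁ : s₁ .order none = [] := by simp [← hs₁]
  refine (run_tabulate D none s₁).mono ?_
  rintro _ s₂ t₂ ⟨hF₂, ho₂, rfl⟩
  refine run_forEach (fun l s' t => (∀ v ∉ l, IsInit s' v) ∧ stored s' none = [] ∧
      s' .cross none = [] ∧ s' .order none = D.verts.reverse ∧ t + 15 * l.length = 15 * n)
    ⟨fun v hv => absurd (List.mem_finRange v) hv, ?_, ?_, ?_, ?_⟩ ?_ ?_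
  · rw [stored, hF₂ .R (by simp)]
    exact hR₁
  · rw [hF₂ .cross (by simp), hc₁]
  · rw [ho₂, ho₁, List.append_nil]
  · simp
  · rintro v l s₃ t₃ ⟨hI, hR₃, hc₃, ho₃, ht₃⟩
    simp only [List.length_cons] at ht₃
    simp only [makeSet, run_bind, run_write]
    generalize hs₄ : Function.update _ Arr.markW _ = s₄
    refine ⟨fun x hx => ?_, ?_, ?_, ?_, by omega⟩
    · by_cases hxv : x = v
      · subst hxv
        constructor
        · intro d; cases d <;> simp [← hs₄, lnk]
        · intro d; cases d <;> simp [← hs₄, rnk]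
        · intro d; cases d <;> simp [← hs₄, lbl]
        · simp [← hs₄, backs]
        · simp [← hs₄, preds]
        · simp [← hs₄, outs]
        · simp [← hs₄, stored]
        · simp [← hs₄]
      · have hx₃ := hI x (by simp [hxv, hx])
        constructor
        · intro d; refine Eq.trans ?_ (hx₃.lnk_eq d); cases d <;> simp [← hs₄, lnk, hxv]
        · intro d; refine Eq.trans ?_ (hx₃.rnk_eq d); cases d <;> simp [← hs₄, rnk, hxv]
        · intro d; refine Eq.trans ?_ (hx₃.lbl_eq d); cases d <;> simp [← hs₄, lbl, hxv]
        · rw [← hx₃.backs_eq]; simp [← hs₄, backs, hxv]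
        · rw [← hx₃.preds_eq]; simp [← hs₄, preds, hxv]
        · rw [← hx₃.outs_eq]; simp [← hs₄, outs, hxv]
        · rw [← hx₃.stored_eq]; simp [← hs₄, stored, hxv]
        · rw [← hx₃.query_eq]; simp [← hs₄, hxv]
    · rw [← hR₃]; simp [← hs₄, stored]
    · rw [← hc₃]; simp [← hs₄]
    · rw [← ho₃]; simp [← hs₄]
  · rintro s₃ t₃ ⟨hI, hR₃, hc₃, ho₃, ht₃⟩
    simp only [List.length_nil] at ht₃
    exact ⟨fun v => hI v (by simp), hR₃, hc₃, ho₃, by omega⟩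

theorem sum_length_push {γ : Type} (f : Option (Fin n) → List γ) (a : Fin n) (x : γ) :
    ∑ v, (Function.update f (some a) (x :: f (some a)) (some v)).length =
      ∑ v, (f (some v)).length + 1 := by
  have : ∀ v : Fin n, (Function.update f (some a) (x :: f (some a)) (some v)).length =
      (f (some v)).length + if v = a then 1 else 0 := by
    intro v
    by_cases h : v = a
    · subst h; simp
    · simp [h]
  simp only [this, Finset.sum_add_distrib, Finset.sum_ite_eq', Finset.mem_univ, if_true]

/-- The cross and forward edges that have been found. -/
def crossing (s : Memory n) : List (Fin n × Fin n) := s .cross none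

/-- The queries of `v`. -/
def queries (s : Memory n) (v : Fin n) : List (Fin n × (Fin n × Fin n)) := s .query (some v)

/-- The amount of data produced by the classification of the edges. -/
def classified (s : Memory n) : ℕ :=
  ∑ v, (backs s v).length + ∑ v, (preds s v).length + ∑ v, (outs s v).length +
    2 * (crossing s).length

/-- A tree edge makes two entries and a back edge one. Counting cross and forward edges twice gives
the uniform bound 2 per edge, and halving it bounds the number of cross and forward edges by that of
all edges. -/
theorem run_classifyEdges (E : List (Fin n × Fin n)) (s : Memory n) :
    Run (classifyEdges E) s fun _ s' t => Frame [.back, .pred, .O, .cross] s s' ∧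
      classified s' ≤ classified s + 2 * E.length ∧ t ≤ 12 * E.length + 1 := by
  refine run_forEach (fun l s' t => Frame [.back, .pred, .O, .cross] s s' ∧
    classified s' + 2 * l.length ≤ classified s + 2 * E.length ∧
      t + 12 * l.length ≤ 12 * E.length) ⟨Frame.refl _ _, le_rfl, by omega⟩ ?_ ?_
  · rintro ⟨u, v⟩ l s₁ t₁ ⟨hF, hc, ht⟩
    simp only [List.length_cons] at hc ht
    simp only [run_bind, run_read, run_test, run_ite, run_modify, decide_eq_true_eq]
    refine ⟨fun _ => ⟨hF.write _ (by simp), ?_, by omega⟩,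
      fun _ => ⟨fun _ => ⟨(hF.write _ (by simp)).write _ (by simp), ?_, by omega⟩,
        fun _ => ⟨hF.write _ (by simp), ?_, by omega⟩⟩⟩
    · have := sum_length_push (s₁ .back) v u
      simp only [classified, crossing, backs, preds, outs, Function.update_self, ne_eq,
        reduceCtorEq, not_false_eq_true, Function.update_of_ne] at hc ⊢
      omega
    · have h1 := sum_length_push (s₁ .pred) v u
      have h2 := sum_length_push (s₁ .O) v (u, v)
      simp only [classified, crossing, backs, preds, outs, Function.update_self, ne_eq,
        reduceCtorEq, not_false_eq_true, Function.update_of_ne] at hc ⊢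
      omega
    · simp only [classified, crossing, backs, preds, outs, Function.update_self, ne_eq,
        reduceCtorEq, not_false_eq_true, Function.update_of_ne, List.length_cons] at hc ⊢
      omega
  · rintro s₁ t₁ ⟨hF, hc, ht⟩
    simp only [List.length_nil] at hc ht
    exact ⟨hF, by omega, by omega⟩

theorem sum_map_le_sum {l : List (Fin n)} (hl : l.Nodup) (f : Fin n → ℕ) :
    (l.map f).sum ≤ ∑ v, f v := by
  rw [← List.sum_toFinset _ hl]
  exact Finset.sum_le_sum_of_subset (Finset.subset_univ _)

/-- The number of stored cross and forward edges. -/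
def numStored (s : Memory n) : ℕ := ∑ v, (stored s (some v)).length + (stored s none).length

/-- Each cross or forward edge yields one query, hence one find and one stored edge; each vertex
causes at most one merge. Where an edge is stored does not affect the totals. -/
theorem run_removeAllCrossForwardEdges {L : ℕ} (hL : n ≤ hier L 1) (hL0 : 0 < L)
    {σ : Fin n → Fin n} {vs : List (Fin n)} (hvs : vs.Nodup) {s : Memory n}
    (hs : IsRep .anc σ s) (ho : s .order none = vs) :
    Run removeAllCrossForwardEdges s fun _ s' t =>
      Frame [.query, .link .anc, .rank .anc, .label .anc, .R] s s' ∧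
      numStored s' ≤ numStored s + ∑ v, (queries s v).length + (crossing s).length ∧
      t ≤ pot L .anc s + 4 * opCost L *
        (∑ v, (queries s v).length + (crossing s).length + n + 1) := by
  have hU := le_opCost L
  simp only [removeAllCrossForwardEdges, run_bind, run_read]
  refine run_forEach (fun l s' t => Frame [.query] s s' ∧
    ∑ v, (queries s' v).length + l.length ≤ ∑ v, (queries s v).length + (crossing s).length ∧
      t + 6 * l.length ≤ 6 * (crossing s).length) ⟨Frame.refl _ _, le_rfl, (Nat.zero_add _).le⟩ ?_ ?_
  · rintro ⟨u, v⟩ l s₁ t₁ ⟨hF, hc, ht⟩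
    simp only [List.length_cons] at hc ht
    simp only [run_bind, run_read, run_test, run_ite, run_modify, decide_eq_true_eq]
    refine ⟨fun _ => ⟨hF.write _ (by simp), ?_, by omega⟩,
      fun _ => ⟨hF.write _ (by simp), ?_, by omega⟩⟩
    · have := sum_length_push (s₁ .query) u (v, (u, v))
      simp only [queries, Function.update_self] at hc ⊢
      omega
    · have := sum_length_push (s₁ .query) v (u, (u, v))
      simp only [queries, Function.update_self] at hc ⊢
      omega
  rintro s₁ t₁ ⟨hF₁, hc₁, ht₁⟩
  simp only [List.length_nil] at hc₁ ht₁
  rw [hF₁ .order (by simp), ho]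
  have hs₁ := hs.frame hF₁ (by simp) (by simp) (by simp)
  have hp₁ := pot_frame (L := L) (d := .anc) hF₁ (by simp) (by simp)
  have hn₁ : numStored s₁ = numStored s := by
    simp only [numStored, stored, hF₁ .R (by simp)]
  refine run_forEach (fun l s' t => (∃ σ', IsRep .anc σ' s') ∧
      Frame [.link .anc, .rank .anc, .label .anc, .R] s₁ s' ∧
      numStored s' + (l.map fun v => (queries s₁ v).length).sum ≤
        numStored s₁ + (vs.map fun v => (queries s₁ v).length).sum ∧
      t + pot L .anc s' + 2 * opCost L * (l.map fun v => (queries s₁ v).length).sum +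
          2 * opCost L * l.length ≤
        pot L .anc s₁ + 2 * opCost L * (vs.map fun v => (queries s₁ v).length).sum +
          2 * opCost L * vs.length)
    ⟨⟨σ, hs₁⟩, Frame.refl _ _, le_rfl, by omega⟩ ?_ ?_
  · rintro w l s₂ t₂ ⟨⟨σ₂, h₂⟩, hF₂, hc₂, ht₂⟩
    simp only [List.map_cons, List.sum_cons, List.length_cons] at hc₂ ht₂
    simp only [run_bind, run_read]
    have hq : s₂ .query (some w) = queries s₁ w := by rw [hF₂ .query (by simp)]; rfl
    rw [hq]
    refine run_forEach (fun l' s' t => IsRep .anc σ₂ s' ∧ Frame [.link .anc, .R] s₂ s' ∧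
        numStored s' + l'.length ≤ numStored s₂ + (queries s₁ w).length ∧
        t + pot L .anc s' + 2 * opCost L * l'.length ≤
          pot L .anc s₂ + 2 * opCost L * (queries s₁ w).length)
      ⟨h₂, Frame.refl _ _, le_rfl, by omega⟩ ?_ ?_
    · rintro ⟨x, e⟩ l' s₃ t₃ ⟨h₃, hF₃, hc₃, ht₃⟩
      simp only [List.length_cons] at hc₃ ht₃
      simp only [run_bind, run_read]
      refine (run_rep hL hL0 x h₃).mono ?_
      rintro _ s₄ t₄ ⟨rfl, h₄, hF₄, ht₄⟩
      have hF := hF₃.trans hF₄ (A := [.link .anc, .R]) (by simp) (by simp)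
      have hn₄ : numStored s₄ = numStored s₃ := by
        simp only [numStored, stored, hF₄ .R (by simp)]
      simp only [run_test, run_ite, run_modify, decide_eq_true_eq]
      refine ⟨fun _ => ⟨?_, hF.write _ (by simp), ?_, ?_⟩,
        fun _ => ⟨?_, hF.write _ (by simp), ?_, ?_⟩⟩
      · exact h₄.congr (by simp) (by simp) (by simp)
      · have := sum_length_push (s₄ .R) (σ₂ x) e
        simp only [numStored, stored, Function.update_self, ne_eq, reduceCtorEq,
          not_false_eq_true, Function.update_of_ne] at hn₄ hc₃ ⊢
        omega
      · rw [pot_congr L (s := s₄) (by simp) (by simp)]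
        linarith
      · exact h₄.congr (by simp) (by simp) (by simp)
      · simp only [numStored, stored, Function.update_self, ne_eq, reduceCtorEq,
          not_false_eq_true, Function.update_of_ne, List.length_cons] at hn₄ hc₃ ⊢
        omega
      · rw [pot_congr L (s := s₄) (by simp) (by simp)]
        linarith
    · rintro s₃ t₃ ⟨h₃, hF₃, hc₃, ht₃⟩
      simp only [List.length_nil] at hc₃ ht₃
      have hF := hF₂.trans hF₃ (A := [.link .anc, .rank .anc, .label .anc, .R]) (by simp) (by simp)
      cases hp : s₃ .parent (some w) with
      | none =>
        simp only [run_pure]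
        exact ⟨⟨σ₂, h₃⟩, hF, by omega, by linarith⟩
      | some p =>
        refine (run_merge hL hL0 w p h₃).mono ?_
        rintro _ s₄ t₄ ⟨⟨σ₄, h₄, -⟩, hF₄, ht₄⟩
        have hn₄ : numStored s₄ = numStored s₃ := by
          simp only [numStored, stored, hF₄ .R (by simp)]
        exact ⟨⟨σ₄, h₄⟩, hF.trans hF₄ (by simp) (by simp), by omega, by linarith⟩
  · rintro s₂ t₂ ⟨-, hF₂, hc₂, ht₂⟩
    simp only [List.map_nil, List.sum_nil, List.length_nil] at hc₂ ht₂
    have h1 := sum_map_le_sum hvs fun v => (queries s₁ v).length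
    have h2 : vs.length ≤ n := by simpa using hvs.length_le_card
    refine ⟨hF₁.trans hF₂ (by simp) (by simp), by omega, ?_⟩
    have e1 := Nat.mul_le_mul_left (opCost L) (h1.trans (Nat.le_of_add_right_le hc₁))
    have e2 := Nat.mul_le_mul_left (opCost L) h2
    have e3 := Nat.mul_le_mul_right (crossing s).length hU
    have e4 := Nat.zero_le (opCost L * ∑ v, (queries s v).length)
    nlinarith

theorem run_constructWPOBU {L : ℕ} (hL : n ≤ hier L 1) (hL0 : 0 < L)
    (E : List (Fin n × Fin n)) (D : Forest (Fin n)) (lift : Bool)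
    (hD : D.verts.reverse.Nodup) (s : Memory n) :
    Run (constructWPOBU E D lift) s fun _ _ t => t ≤ 1000 * opCost L * (n + E.length + 1) := by
  have hU := le_opCost L
  simp only [constructWPOBU, run_bind, run_read, run_pure]
  refine (run_setup D s).mono ?_
  rintro _ s₁ _ ⟨hI, hR₁, hc₁, ho₁, rfl⟩
  refine (run_classifyEdges E s₁).mono ?_
  rintro _ s₂ t₂ ⟨hF₂, hc₂, ht₂⟩
  have hR₂ : numStored s₂ = 0 := by
    have : ∀ h, stored s₂ h = stored s₁ h := fun h => by simp only [stored, hF₂ .R (by simp)]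
    simp [numStored, this, hR₁, (hI _).stored_eq]
  have hq₂ : ∑ v, (queries s₂ v).length = 0 := by
    simp [queries, hF₂ .query (by simp), (hI _).query_eq]
  have hC₁ : classified s₁ = 0 := by
    simp [classified, (hI _).backs_eq, (hI _).preds_eq, (hI _).outs_eq, crossing, hc₁]
  have hC₂ : ∑ v, (backs s₂ v).length + ∑ v, (preds s₂ v).length + ∑ v, (outs s₂ v).length +
    2 * (crossing s₂).length ≤ 2 * E.length := by rwa [hC₁, Nat.zero_add] at hc₂
  have hanc₂ := (IsInit.isRep hI .anc).frame hF₂ (by simp) (by simp) (by simp)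
  have hscc₂ := (IsInit.isRep hI .scc).frame hF₂ (by simp) (by simp) (by simp)
  have ho₂ : s₂ .order none = D.verts.reverse := by rw [hF₂ .order (by simp), ho₁]
  have hpa₂ : pot L .anc s₂ = 0 := by
    rw [pot_frame hF₂ (by simp) (by simp), IsInit.pot hI]
  have hps₂ : pot L .scc s₂ = 0 := by
    rw [pot_frame hF₂ (by simp) (by simp), IsInit.pot hI]
  refine (run_removeAllCrossForwardEdges hL hL0 hD hanc₂ ho₂).mono ?_
  rintro _ s₃ t₃ ⟨hF₃, hR₃, ht₃⟩
  rw [hF₃ .order (by simp), ho₂]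
  have hscc₃ := hscc₂.frame hF₃ (by simp) (by simp) (by simp)
  have hps₃ : pot L .scc s₃ = 0 := by rw [pot_frame hF₃ (by simp) (by simp), hps₂]
  refine (run_mainLoop hL hL0 lift hD hscc₃).mono ?_
  rintro _ s₄ t₄ ⟨σ₄, hscc₄, hR₄, ht₄⟩
  refine (run_restore hL hL0 none hscc₄).mono ?_
  rintro _ s₅ t₅ ⟨hscc₅, hF₅, hc₅, ht₅⟩
  refine (run_connectWPOsOfMaximalSCCs hL hL0 lift hscc₅).mono ?_
  rintro _ s₆ t₆ ht₆
  have hw : wt s₃ = wt s₂ := wt_frame hF₃ (by simp) (by simp)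
  have hb : backs s₃ = backs s₂ := by
    funext v
    simp only [backs, hF₃ .back (by simp)]
  have hs₄ : stored s₄ none = stored s₃ none := by simp only [stored, hR₄]
  have hwt : ∑ v, wt s₂ v = ∑ v, (preds s₂ v).length + ∑ v, (outs s₂ v).length + n := by
    simp [wt, Finset.sum_add_distrib]
  have hcr : ∑ v, credit id D.verts.reverse v * wt s₃ v ≤ 2 * ∑ v, wt s₂ v := by
    rw [hw, Finset.mul_sum]
    exact Finset.sum_le_sum fun v _ => Nat.mul_le_mul_right _ (credit_le _ _ _)
  have hsum := sum_map_le_sum hD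
    fun v => (backs s₃ v).length + (stored s₃ (some v)).length + 1
  have hsum' : ∑ v, ((backs s₃ v).length + (stored s₃ (some v)).length + 1) =
      ∑ v, (backs s₂ v).length + ∑ v, (stored s₃ (some v)).length + n := by
    simp [hb, Finset.sum_add_distrib]
  have hlen : D.verts.length ≤ n := by simpa using hD.length_le_card
  have hcr₅ := hc₅ (credit σ₄ []) (credit_le _ _)
  rw [hs₄] at ht₅ hcr₅
  unfold numStored at hR₂ hR₃
  have hst : ∑ v, (stored s₃ (some v)).length + (stored s₃ none).length ≤ E.length := by
    simp only [hR₂, hq₂] at hR₃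
    omega
  generalize hX : n + E.length + 1 = X
  generalize hU' : opCost L = U at *
  have e0 : 30 * X ≤ U * X := Nat.mul_le_mul_right X hU
  have e1 : U * ((crossing s₂).length + n + 1) ≤ U * X := Nat.mul_le_mul_left U (by omega)
  -- Credits are at most 2, and the total weight is at most `2 * E.length + n`.
  have e2 : U * ∑ v, credit id D.verts.reverse v * wt s₃ v ≤ U * (4 * X) :=
    Nat.mul_le_mul_left U (by omega)
  have e3 := Nat.mul_le_mul_left U (hsum.trans (hsum'.le.trans
    (show _ ≤ 3 * X by omega)))
  have e4 : U * ((stored s₃ none).length + 1) ≤ U * X := Nat.mul_le_mul_left U (by omega)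
  have e5 := Nat.mul_le_mul_left U hcr₅
  have e6 : U * n ≤ U * X := Nat.mul_le_mul_left U (by omega)
  have e7 := Nat.zero_le (U * ∑ v, credit σ₄ [] v * wt s₄ v)
  have e8 := Nat.zero_le (pot L .scc s₄)
  rw [hps₃] at ht₄
  rw [hpa₂, hq₂] at ht₃
  rw [mul_assoc] at ht₃ ht₅
  have h1 : t₂ ≤ U * X := by omega
  have h0 : 10 * D.verts.length + 15 * n + 9 ≤ U * X := by omega
  nlinarith

end WPO

/-! ### The almost-linear bound -/

theorem mainTheorem3 :
    ∃ C : ℕ, ∀ (n : ℕ) (E : List (Fin n × Fin n)) (D : WPO.Forest (Fin n)) (lift : Bool),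
      E.Nodup → WPO.IsDepthFirstForest (fun u v => (u, v) ∈ E) D →
      ∀ s₀ : WPO.Memory n, ∃ (W : WPO.Output n) (s : WPO.Memory n) (t : ℕ),
        WPO.constructWPOBU E D lift s₀ = some (W, s, t) ∧
        t ≤ C * (n + E.length + 1) * (WPO.invAck n + 1) := by
  -- With L = α + 1, `1000 * opCost L` is 1000 (9α + 39), which is at most 40000 (α + 1).
  refine ⟨40000, fun n E D lift _ hD s₀ => ?_⟩
  have hL := WPO.le_hier_invAck n
  have hL0 : 0 < WPO.invAck n + 1 := Nat.succ_pos _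
  have hn : D.verts.reverse.Nodup := List.nodup_reverse.mpr (WPO.DFS.verts_nodup hD).1
  exact (WPO.run_constructWPOBU hL hL0 E D lift hn s₀).mono
    fun _ _ _ h => h.trans (by unfold WPO.opCost; nlinarith)
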